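/- Let $R$ be a resource semiring, i.e. a (not necessarily commutative) semiring with a partial order for which $+$ and $\cdot$ are monotone in both arguments. **Doctrines.** A *primary linear doctrine* is a functor $P:\mathcal C^{op}\to \mathbf{Pos}$ on a category $\mathcal C$ with chosen finite products, whose fibres $P(X)$ are ordered commutative monoids $(P(X),\le,\ast,\kappa)$ and whose reindexing maps $P_t$ are monoid homomorphisms. An *$R$-graded doctrine* is such a $P$ with natural transformations $m_r:P\to P$ ($r\in R$) such that, in every fibre, $\kappa\le m_r\kappa$, $m_r\alpha\ast m_r\beta\le m_r(\alpha\ast\beta)$, $m_0\alpha\le\kappa$, $m_{r+s}\alpha\le m_r\alpha\ast m_s\alpha$, $m_1\alpha\le\alpha$, $m_{rs}\alpha\le m_rm_s\alpha$, and $m_r\alpha\le m_s\alpha$ whenever $s\le r$. A *distance* on $A\in\mathcal C$ is $\rho\in P(A\times A)$ with $\kappa\le P_{\langle id,id\rangle}\rho$, $\rho\le P_{\langle\pi_2,\pi_1\rangle}\rho$ and $P_{\langle\pi_1,\pi_2\rangle}\rho\ast P_{\langle\pi_2,\pi_3\rangle}\rho\le P_{\langle\pi_1,\pi_3\rangle}\rho$;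 it is *affine* if $\rho\le\kappa$. For distances $\rho$ on $A$ and $\sigma$ on $B$ put $\rho\boxtimes\sigma=P_{\pi_1\times\pi_1}\rho\ast P_{\pi_2\times\pi_2}\sigma\in P((A\times B)\times(A\times B))$. An *$R$-Lipschitz doctrine* is an $R$-graded doctrine with a distance $\delta_A$ on each object $A$ such that, for all $A,X$: (a) for each $\alpha\in P(X\times A)$ there is $r\in R$ with $P_{\langle\pi_1,\pi_2\rangle}\alpha\ast m_rP_{\langle\pi_2,\pi_3\rangle}\delta_A\le P_{\langle\pi_1,\pi_3\rangle}\alpha$ over $X\times A\times A$; (b) $\delta_{A\times X}=\delta_A\boxtimes\delta_X$; (c) $\delta_{A\times X}\le P_{\pi_1\times\pi_1}\delta_A$ and $\delta_{A\times X}\le P_{\pi_2\times\pi_2}\delta_X$; (d) $\delta_1=\kappa$. **2-categories.** In the 2-category $\mathbf{GD}_R$ of $R$-graded doctrines, a 1-arrow $(F,f):P\to Q$ consists of a functor $F$ between the bases that strictly preserves the chosen finite products and a natural transformation $f:P\to Q\circ F^{op}$ whose components are monotone monoid homomorphisms commuting with every $m_r$; a 2-arrow $(F,f)\Rightarrow(G,g)$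 is a natural transformation $\theta:F\to G$ with $f_X(\alpha)\le Q_{\theta_X}(g_X(\alpha))$ for all $X$ and $\alpha\in P(X)$. In the 2-category $\mathbf{LD}_R$ of $R$-Lipschitz doctrines, 1-arrows are those $(F,f)$ with $\delta'_{FA}=f_{A\times A}(\delta_A)$ for all $A$, and 2-arrows are as before. Let $U:\mathbf{LD}_R\to\mathbf{GD}_R$ be the forgetful 2-functor. **Lipschitz completion.** For an $R$-graded doctrine $P$, the $R$-Lipschitz doctrine $M(P)$ has the following data. Objects of its base are pairs $(A,\rho)$ with $\rho$ an affine distance on $A$; arrows $(A,\rho)\to(B,\sigma)$ are arrows $t:A\to B$ with $m_r\rho\le P_{t\times t}\sigma$ for some $r\in R$; the chosen products are $(A\times B,\rho\boxtimes\sigma)$ and $(1,\kappa)$. The fibre over $(A,\rho)$ is the set of $\alpha\in P(A)$ with $P_{\pi_1}\alpha\ast m_r\rho\le P_{\pi_2}\alpha$ for some $r\in R$, with order, monoid structure, reindexing and modalities inherited from $P$; the distance on $(A,\rho)$ is $\rho$. On arrows, $M(F,f)=(\overline F,f)$ with $\overline F(A,\rho)=(FA,f_{A\times A}(\rho))$ and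 $\overline Ft=Ft$, and $M(\theta)=\theta$. This defines a 2-functor $M:\mathbf{GD}_R\to\mathbf{LD}_R$. **Theorem.** The forgetful 2-functor $U:\mathbf{LD}_R\to\mathbf{GD}_R$ is 2-comonadic. That is: 1. $M$ is right 2-adjoint to $U$. The counit at $P$ is the 1-arrow $UM(P)\to P$ sending $(A,\rho)$ to $A$, identical on arrows and including the fibre over $(A,\rho)$ into $P(A)$; the unit at an $R$-Lipschitz doctrine $Q$ is the 1-arrow $Q\to MU(Q)$ sending $A$ to $(A,\delta_A)$, identical on arrows and on fibres. 2. The comparison 2-functor from $\mathbf{LD}_R$ to the 2-category of (strict) coalgebras, strict coalgebra morphisms and coalgebra 2-cells of the induced 2-comonad $U\circ M$ on $\mathbf{GD}_R$ is an isomorphism of 2-categories. -/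

import Mathlib

namespace TwoCat

open CategoryTheory Bicategory

universe w₁ w₂ v₁ v₂ u₁ u₂

variable {B : Type u₁} [Bicategory.{w₁, v₁} B] {C : Type u₂} [Bicategory.{w₂, v₂} C]

/-- A (strict) 2-natural transformation between 2-functors. -/
structure TwoNatTrans (F G : StrictPseudofunctor B C) where
  app (a : B) : F.obj a ⟶ G.obj a
  naturality {a b : B} (f : a ⟶ b) : F.map f ≫ app b = app a ≫ G.map f
  naturality₂ {a b : B} {f g : a ⟶ b} (η : f ⟶ g) :
    F.map₂ η ▷ app b =
      eqToHom (naturality f) ≫ (app a ◁ G.map₂ η) ≫ eqToHom (naturality g).symm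

/-- A 2-adjunction `L ⊣ R` (unit and counit 2-natural, triangle identities strict). -/
structure TwoAdjunction (L : StrictPseudofunctor B C) (R : StrictPseudofunctor C B) where
  unit : TwoNatTrans (StrictPseudofunctor.id B) (L.comp R)
  counit : TwoNatTrans (R.comp L) (StrictPseudofunctor.id C)
  left_triangle (a : B) :
    (L.map (unit.app a) : L.obj a ⟶ L.obj (R.obj (L.obj a))) ≫ counit.app (L.obj a) = 𝟙 (L.obj a)
  right_triangle (x : C) :
    (unit.app (R.obj x) : R.obj x ⟶ R.obj (L.obj (R.obj x))) ≫ R.map (counit.app x)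
      = 𝟙 (R.obj x)

/-- A 2-comonad on a 2-category. -/
structure TwoComonad (C : Type u₂) [Bicategory.{w₂, v₂} C] where
  T : StrictPseudofunctor C C
  counit : TwoNatTrans T (StrictPseudofunctor.id C)
  comult : TwoNatTrans T (T.comp T)
  counit_left (x : C) :
    (comult.app x : T.obj x ⟶ T.obj (T.obj x)) ≫ counit.app (T.obj x) = 𝟙 (T.obj x)
  counit_right (x : C) :
    (comult.app x : T.obj x ⟶ T.obj (T.obj x)) ≫ T.map (counit.app x) = 𝟙 (T.obj x)
  coassoc (x : C) :
    (comult.app x : T.obj x ⟶ T.obj (T.obj x)) ≫ comult.app (T.obj x) =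
      comult.app x ≫ T.map (comult.app x)

section transport

lemma conj_eqToHom_cancel {D : Type u₁} [Category.{v₁} D] {a b c d a' b' c' d' : D}
    {x : a ⟶ b} {y : c ⟶ d} {e₁ : a' = a} {e₂ : b = b'} {e₃ : a' = c'} {e₄ : c' = c} {e₅ : d = d'}
    {e₆ : d' = b'} (h : eqToHom e₁ ≫ x ≫ eqToHom e₂ =
      eqToHom e₃ ≫ (eqToHom e₄ ≫ y ≫ eqToHom e₅) ≫ eqToHom e₆) :
    x = eqToHom (e₁.symm.trans (e₃.trans e₄)) ≫ y ≫ eqToHom (e₅.trans (e₆.trans e₂.symm)) := by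
  subst e₁ e₂ e₃ e₄ e₅; simpa using h

lemma whiskerRight_congr {a b c : C} {f f' : a ⟶ b} (η : f ⟶ f') {g g' : b ⟶ c} (h : g = g') :
    η ▷ g = eqToHom (by rw [h]) ≫ η ▷ g' ≫ eqToHom (by rw [h]) := by
  subst h; simp

lemma whiskerLeft_congr {a b c : C} {f f' : a ⟶ b} (h : f = f') {g g' : b ⟶ c} (η : g ⟶ g') :
    f ◁ η = eqToHom (by rw [h]) ≫ f' ◁ η ≫ eqToHom (by rw [h]) := by
  subst h; simp

lemma map₂_whiskerLeft_eq (F : StrictPseudofunctor B C) {a b c : B} (f : a ⟶ b)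
    {g g' : b ⟶ c} (η : g ⟶ g') :
    F.map₂ (f ◁ η) = eqToHom (F.map_comp f g) ≫ (F.map f ◁ F.map₂ η) ≫
      eqToHom (F.map_comp f g').symm := by
  rw [F.map₂_whisker_left]; simp [F.mapComp_eq_eqToIso]

lemma map₂_whiskerRight_eq (F : StrictPseudofunctor B C) {a b c : B} {f f' : a ⟶ b}
    (η : f ⟶ f') (g : b ⟶ c) :
    F.map₂ (η ▷ g) = eqToHom (F.map_comp f g) ≫ (F.map₂ η ▷ F.map g) ≫
      eqToHom (F.map_comp f' g).symm := by
  rw [F.map₂_whisker_right]; simp [F.mapComp_eq_eqToIso]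

variable [Strict C]

lemma whiskerRight_comp_eq {a b c d : C} {f f' : a ⟶ b} (η : f ⟶ f') (g : b ⟶ c) (h : c ⟶ d) :
    η ▷ (g ≫ h) = eqToHom (Strict.assoc f g h).symm ≫ (η ▷ g) ▷ h ≫
      eqToHom (Strict.assoc f' g h) := by
  rw [whiskerRight_comp]; simp [Strict.associator_eqToIso]

lemma comp_whiskerLeft_eq {a b c d : C} (f : a ⟶ b) (g : b ⟶ c) {h h' : c ⟶ d} (η : h ⟶ h') :
    (f ≫ g) ◁ η = eqToHom (Strict.assoc f g h) ≫ f ◁ g ◁ η ≫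
      eqToHom (Strict.assoc f g h').symm := by
  rw [comp_whiskerLeft]; simp [Strict.associator_eqToIso]

lemma whisker_assoc_eq {a b c d : C} (f : a ⟶ b) {g g' : b ⟶ c} (η : g ⟶ g') (h : c ⟶ d) :
    (f ◁ η) ▷ h = eqToHom (Strict.assoc f g h) ≫ f ◁ (η ▷ h) ≫
      eqToHom (Strict.assoc f g' h).symm := by
  rw [whisker_assoc]; simp [Strict.associator_eqToIso]

end transport

namespace TwoAdjunction

variable {L : StrictPseudofunctor B C} {R : StrictPseudofunctor C B}

/-- The 2-comonad `L R` induced by a 2-adjunction `L ⊣ R`. -/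
def comonad (adj : TwoAdjunction L R) : TwoComonad C where
  T := R.comp L
  counit := adj.counit
  comult :=
    { app x := L.map (adj.unit.app (R.obj x))
      naturality {x y} f := by
        have h := congrArg L.map (adj.unit.naturality (R.map f))
        exact (L.map_comp _ _).symm.trans (h.trans (L.map_comp _ _))
      naturality₂ {x y f g} η := by
        have h := congrArg L.map₂ (adj.unit.naturality₂ (R.map₂ η))
        rw [L.map₂_comp, L.map₂_comp, PrelaxFunctor.map₂_eqToHom, PrelaxFunctor.map₂_eqToHom] at h
        have h1 := map₂_whiskerRight_eq L (R.map₂ η) (adj.unit.app (R.obj y))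
        have h2 := map₂_whiskerLeft_eq L (adj.unit.app (R.obj x)) (R.map₂ (L.map₂ (R.map₂ η)))
        have h3 := (h1.symm.trans h).trans
          (congrArg (fun t => eqToHom _ ≫ t ≫ eqToHom _) h2)
        exact conj_eqToHom_cancel h3 }
  counit_left x := adj.left_triangle (R.obj x)
  counit_right x := by
    have h := congrArg L.map (adj.right_triangle x)
    exact (L.map_comp _ _).symm.trans (h.trans (L.map_id _))
  coassoc x := by
    have h := congrArg L.map (adj.unit.naturality (adj.unit.app (R.obj x)))
    exact (L.map_comp _ _).symm.trans (h.trans (L.map_comp _ _))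

end TwoAdjunction

namespace TwoComonad

variable (G : TwoComonad C)

/-- A (strict) coalgebra for a 2-comonad. -/
structure Coalgebra where
  X : C
  str : X ⟶ G.T.obj X
  counit : str ≫ G.counit.app X = 𝟙 X
  coassoc : (str ≫ G.comult.app X : X ⟶ G.T.obj (G.T.obj X)) = str ≫ G.T.map str

variable {G}

namespace Coalgebra

/-- A (strict) morphism of coalgebras. -/
@[ext]
structure Hom (a b : G.Coalgebra) where
  f : a.X ⟶ b.X
  comm : f ≫ b.str = a.str ≫ G.T.map f

variable [Strict C]

instance : CategoryStruct G.Coalgebra where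
  Hom a b := Hom a b
  id a := ⟨𝟙 a.X, by rw [Strict.id_comp, G.T.map_id, Strict.comp_id]⟩
  comp {a b c} φ ψ := ⟨φ.f ≫ ψ.f, by
    rw [Strict.assoc, ψ.comm, ← Strict.assoc, φ.comm, Strict.assoc, G.T.map_comp]⟩

@[simp] lemma id_f (a : G.Coalgebra) : Hom.f (𝟙 a) = 𝟙 a.X := rfl
@[simp] lemma comp_f {a b c : G.Coalgebra} (φ : a ⟶ b) (ψ : b ⟶ c) :
    Hom.f (φ ≫ ψ) = φ.f ≫ ψ.f := rfl

/-- A 2-cell between morphisms of coalgebras. -/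
@[ext]
structure Hom₂ {a b : G.Coalgebra} (φ ψ : a ⟶ b) where
  η : φ.f ⟶ ψ.f
  comm : η ▷ b.str = eqToHom φ.comm ≫ (a.str ◁ G.T.map₂ η) ≫ eqToHom ψ.comm.symm

instance (a b : G.Coalgebra) : Category (a ⟶ b) where
  Hom φ ψ := Hom₂ φ ψ
  id φ := ⟨𝟙 φ.f, by simp⟩
  comp α β := ⟨α.η ≫ β.η, by simp [α.comm, β.comm]⟩

@[ext]
lemma hom₂_ext {a b : G.Coalgebra} {φ ψ : a ⟶ b} {α β : φ ⟶ ψ} (h : α.η = β.η) : α = β :=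
  Hom₂.ext h

@[simp] lemma id_η {a b : G.Coalgebra} (φ : a ⟶ b) : Hom₂.η (𝟙 φ) = 𝟙 φ.f := rfl
@[simp] lemma comp_η {a b : G.Coalgebra} {φ ψ χ : a ⟶ b} (α : φ ⟶ ψ) (β : ψ ⟶ χ) :
    Hom₂.η (α ≫ β) = α.η ≫ β.η := rfl

lemma eqToHom_η {a b : G.Coalgebra} {φ ψ : a ⟶ b} (h : φ = ψ) :
    Hom₂.η (eqToHom h) = eqToHom (congrArg Hom.f h) := by subst h; rfl

lemma hcomp_assoc {a b c d : G.Coalgebra} (φ : a ⟶ b) (ψ : b ⟶ c) (χ : c ⟶ d) :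
    (φ ≫ ψ) ≫ χ = φ ≫ ψ ≫ χ := Hom.ext (Strict.assoc _ _ _)
lemma hid_comp {a b : G.Coalgebra} (φ : a ⟶ b) : 𝟙 a ≫ φ = φ := Hom.ext (Strict.id_comp _)
lemma hcomp_id {a b : G.Coalgebra} (φ : a ⟶ b) : φ ≫ 𝟙 b = φ := Hom.ext (Strict.comp_id _)

def whiskerL {a b c : G.Coalgebra} (φ : a ⟶ b) {ψ χ : b ⟶ c} (α : ψ ⟶ χ) : φ ≫ ψ ⟶ φ ≫ χ :=
  Hom₂.mk (φ := φ ≫ ψ) (ψ := φ ≫ χ) (φ.f ◁ α.η) (by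
    dsimp only [comp_f]
    have h1 := comp_whiskerLeft_eq φ.f b.str (G.T.map₂ α.η)
    rw [whiskerLeft_congr φ.comm, comp_whiskerLeft_eq, eq_comm, eqToHom_comp_iff,
      comp_eqToHom_iff] at h1
    rw [whisker_assoc_eq, α.comm, map₂_whiskerLeft_eq]
    simp only [Bicategory.whiskerLeft_comp, whiskerLeft_eqToHom, Category.assoc, eqToHom_trans,
      eqToHom_trans_assoc, h1])

def whiskerR {a b c : G.Coalgebra} {φ ψ : a ⟶ b} (α : φ ⟶ ψ) (χ : b ⟶ c) : φ ≫ χ ⟶ ψ ≫ χ :=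
  Hom₂.mk (φ := φ ≫ χ) (ψ := ψ ≫ χ) (α.η ▷ χ.f) (by
    dsimp only [comp_f]
    have h1 := whiskerRight_comp_eq α.η χ.f c.str
    rw [whiskerRight_congr _ χ.comm, whiskerRight_comp_eq, α.comm, eq_comm, eqToHom_comp_iff,
      comp_eqToHom_iff] at h1
    rw [h1, map₂_whiskerRight_eq]
    simp only [Bicategory.comp_whiskerRight, eqToHom_whiskerRight, Category.assoc, eqToHom_trans,
      eqToHom_trans_assoc, whisker_assoc_eq, Bicategory.whiskerLeft_comp, whiskerLeft_eqToHom])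

instance : Bicategory G.Coalgebra where
  whiskerLeft φ _ _ α := whiskerL φ α
  whiskerRight α χ := whiskerR α χ
  associator φ ψ χ := eqToIso (hcomp_assoc φ ψ χ)
  leftUnitor φ := eqToIso (hid_comp φ)
  rightUnitor φ := eqToIso (hcomp_id φ)
  whiskerLeft_id φ ψ := hom₂_ext (Bicategory.whiskerLeft_id _ _)
  whiskerLeft_comp φ _ _ _ α β := hom₂_ext (Bicategory.whiskerLeft_comp _ _ _)
  id_whiskerRight φ ψ := hom₂_ext (Bicategory.id_whiskerRight _ _)
  comp_whiskerRight α β χ := hom₂_ext (Bicategory.comp_whiskerRight _ _ _)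
  id_whiskerLeft α := by
    apply hom₂_ext
    refine (Bicategory.id_whiskerLeft _).trans ?_
    simp [Strict.leftUnitor_eqToIso, eqToHom_η]
  comp_whiskerLeft φ ψ _ _ α := by
    apply hom₂_ext
    refine (comp_whiskerLeft_eq _ _ _).trans ?_
    simp [eqToHom_η, whiskerL]
  whiskerRight_id α := by
    apply hom₂_ext
    refine (Bicategory.whiskerRight_id _).trans ?_
    simp [Strict.rightUnitor_eqToIso, eqToHom_η]
  whiskerRight_comp α φ ψ := by
    apply hom₂_ext
    refine (whiskerRight_comp_eq _ _ _).trans ?_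
    simp [eqToHom_η, whiskerR]
  whisker_assoc φ _ _ α ψ := by
    apply hom₂_ext
    refine (whisker_assoc_eq _ _ _).trans ?_
    simp [eqToHom_η, whiskerL, whiskerR]
  whisker_exchange α β := hom₂_ext (Bicategory.whisker_exchange _ _)
  pentagon φ ψ χ ω := by
    apply hom₂_ext
    simp [eqToHom_η, whiskerL, whiskerR]
  triangle φ ψ := by
    apply hom₂_ext
    simp [eqToHom_η, whiskerL, whiskerR]

instance : Strict G.Coalgebra where
  id_comp := hid_comp
  comp_id := hcomp_id
  assoc := hcomp_assoc
  leftUnitor_eqToIso _ := rfl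
  rightUnitor_eqToIso _ := rfl
  associator_eqToIso _ _ _ := rfl

end Coalgebra
end TwoComonad

namespace TwoAdjunction

variable [Strict B] [Strict C] {L : StrictPseudofunctor B C} {R : StrictPseudofunctor C B}

/-- The comparison 2-functor to the 2-category of coalgebras of the induced 2-comonad. -/
def comparison (adj : TwoAdjunction L R) : StrictPseudofunctor B adj.comonad.Coalgebra :=
  StrictPseudofunctor.mk''
    { obj a :=
        { X := L.obj a
          str := L.map (adj.unit.app a)
          counit := adj.left_triangle a
          coassoc := by
            have h := congrArg L.map (adj.unit.naturality (adj.unit.app a))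
            exact (L.map_comp _ _).symm.trans (h.trans (L.map_comp _ _)) }
      map f :=
        { f := L.map f
          comm := by
            have h := congrArg L.map (adj.unit.naturality f)
            exact (L.map_comp _ _).symm.trans (h.trans (L.map_comp _ _)) }
      map₂ {a b f g} η :=
        { η := L.map₂ η
          comm := by
            have h := congrArg L.map₂ (adj.unit.naturality₂ η)
            rw [L.map₂_comp, L.map₂_comp, PrelaxFunctor.map₂_eqToHom,
              PrelaxFunctor.map₂_eqToHom] at h
            have h1 := map₂_whiskerRight_eq L η (adj.unit.app b)
            have h2 := map₂_whiskerLeft_eq L (adj.unit.app a) (R.map₂ (L.map₂ η))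
            have h3 := (h1.symm.trans h).trans
              (congrArg (fun t => eqToHom _ ≫ t ≫ eqToHom _) h2)
            exact conj_eqToHom_cancel h3 }
      map₂_id f := TwoComonad.Coalgebra.hom₂_ext (L.map₂_id f)
      map₂_comp η θ := TwoComonad.Coalgebra.hom₂_ext (L.map₂_comp η θ)
      map_id a := TwoComonad.Coalgebra.Hom.ext (L.map_id a)
      map_comp f g := TwoComonad.Coalgebra.Hom.ext (L.map_comp f g)
      map₂_whisker_left f _ _ η := TwoComonad.Coalgebra.hom₂_ext <| by
        refine (map₂_whiskerLeft_eq L f η).trans ?_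
        simp only [TwoComonad.Coalgebra.comp_η, TwoComonad.Coalgebra.eqToHom_η]
        rfl
      map₂_whisker_right η g := TwoComonad.Coalgebra.hom₂_ext <| by
        refine (map₂_whiskerRight_eq L η g).trans ?_
        simp only [TwoComonad.Coalgebra.comp_η, TwoComonad.Coalgebra.eqToHom_η]
        rfl }

end TwoAdjunction

/-- A 2-functor is an isomorphism of 2-categories if it has a strict two-sided inverse
2-functor. -/
def IsIsoOfTwoCategories (F : StrictPseudofunctor B C) : Prop :=
  ∃ G : StrictPseudofunctor C B,
    F.comp G = StrictPseudofunctor.id B ∧ G.comp F = StrictPseudofunctor.id C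

end TwoCat

namespace LipDoc

open CategoryTheory Opposite

universe u v w u' v' u'' v''

section

set_option linter.checkUnivs false
set_option linter.unusedVariables false

/-- A resource semiring: a semiring in the category of posets. -/
class ResourceSemiring (R : Type*) extends Semiring R, PartialOrder R where
  add_mono : ∀ {r r' s s' : R}, r ≤ r' → s ≤ s' → r + s ≤ r' + s'
  mul_mono : ∀ {r r' s s' : R}, r ≤ r' → s ≤ s' → r * s ≤ r' * s'

section Doctrines

open MonoidalCategory CartesianMonoidalCategory

/-- A doctrine: a category with (chosen) finite products and a functor `Cᵒᵖ ⥤ PartOrd`. -/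
structure Doctrine where
  C : Type u
  [cat : Category.{v} C]
  [prod : CartesianMonoidalCategory C]
  P : Cᵒᵖ ⥤ PartOrd.{w}

attribute [instance] Doctrine.cat Doctrine.prod

namespace Doctrine

variable (D : Doctrine.{u, v, w})

/-- The fibre over an object. -/
abbrev fib (X : D.C) : Type w := D.P.obj (op X)

/-- Reindexing along an arrow. -/
def re {X Y : D.C} (f : X ⟶ Y) (α : D.fib Y) : D.fib X := D.P.map f.op α

variable {D}

@[simp] lemma re_id {X : D.C} (α : D.fib X) : D.re (𝟙 X) α = α := by simp [re]

lemma re_comp {X Y Z : D.C} (f : X ⟶ Y) (g : Y ⟶ Z) (α : D.fib Z) :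
    D.re (f ≫ g) α = D.re f (D.re g α) := by simp [re]

lemma re_mono {X Y : D.C} (f : X ⟶ Y) {α β : D.fib Y} (h : α ≤ β) : D.re f α ≤ D.re f β :=
  (D.P.map f.op).hom.monotone h

end Doctrine

/-- A primary linear doctrine: each fibre is an ordered commutative monoid and the monoid
structure is preserved by reindexing. `α * β` and `1` are written `α ∗ β` and `κ` in the
literature. -/
structure LinearDoctrine extends Doctrine.{u, v, w} where
  [mon : ∀ X : C, CommMonoid (toDoctrine.fib X)]
  [ordMon : ∀ X : C, IsOrderedMonoid (toDoctrine.fib X)]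
  re_mul : ∀ {X Y : C} (f : X ⟶ Y) (α β : toDoctrine.fib Y),
    toDoctrine.re f (α * β) = toDoctrine.re f α * toDoctrine.re f β
  re_one : ∀ {X Y : C} (f : X ⟶ Y), toDoctrine.re f (1 : toDoctrine.fib Y) = 1

attribute [instance] LinearDoctrine.mon LinearDoctrine.ordMon

namespace LinearDoctrine

variable {D : LinearDoctrine.{u, v, w}}

/-- `ρ` is a distance on the object `A`. In `A ⊗ (A ⊗ A)` the three projections are
`fst`, `snd ≫ fst` and `snd ≫ snd`. -/
structure IsDistance (A : D.C) (ρ : D.fib (A ⊗ A)) : Prop where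
  refl : 1 ≤ D.re (lift (𝟙 A) (𝟙 A)) ρ
  symm : ρ ≤ D.re (lift (snd A A) (fst A A)) ρ
  trans :
    D.re (lift (fst A (A ⊗ A)) (snd A (A ⊗ A) ≫ fst A A)) ρ *
        D.re (lift (snd A (A ⊗ A) ≫ fst A A) (snd A (A ⊗ A) ≫ snd A A)) ρ ≤
      D.re (lift (fst A (A ⊗ A)) (snd A (A ⊗ A) ≫ snd A A)) ρ

/-- An element of a fibre is affine if it lies below the monoid unit. -/
def IsAffine {X : D.C} (α : D.fib X) : Prop := α ≤ 1

/-- The product `ρ ⊠ σ` of two distances, i.e. `ρ(π₁, π₃) * σ(π₂, π₄)`. -/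
def boxDist {A B : D.C} (ρ : D.fib (A ⊗ A)) (σ : D.fib (B ⊗ B)) : D.fib ((A ⊗ B) ⊗ (A ⊗ B)) :=
  D.re (fst A B ⊗ₘ fst A B) ρ * D.re (snd A B ⊗ₘ snd A B) σ

end LinearDoctrine

/-- An `R`-graded doctrine: a primary linear doctrine with an `R`-graded linear exponential
modality. -/
structure GradedDoctrine (R : Type*) [ResourceSemiring R] extends LinearDoctrine.{u, v, w} where
  mod : R → (P ⟶ P)
  one_le_mod : ∀ (r : R) (X : C), (1 : toDoctrine.fib X) ≤ (mod r).app (op X) 1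
  mod_mul : ∀ (r : R) {X : C} (α β : toDoctrine.fib X),
    (mod r).app (op X) α * (mod r).app (op X) β ≤ (mod r).app (op X) (α * β)
  mod_zero : ∀ {X : C} (α : toDoctrine.fib X), (mod 0).app (op X) α ≤ (1 : toDoctrine.fib X)
  mod_add : ∀ (r s : R) {X : C} (α : toDoctrine.fib X),
    (mod (r + s)).app (op X) α ≤
      ((mod r).app (op X) α * (mod s).app (op X) α : toDoctrine.fib X)
  mod_one : ∀ {X : C} (α : toDoctrine.fib X), (mod 1).app (op X) α ≤ α
  mod_mul_grade : ∀ (r s : R) {X : C} (α : toDoctrine.fib X),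
    (mod (r * s)).app (op X) α ≤ (mod r).app (op X) ((mod s).app (op X) α)
  mod_anti : ∀ {r s : R}, s ≤ r → ∀ {X : C} (α : toDoctrine.fib X),
    (mod r).app (op X) α ≤ (mod s).app (op X) α

namespace GradedDoctrine

variable {R : Type*} [ResourceSemiring R]

/-- The component of the `r`-th modality on a fibre. -/
def bang (D : GradedDoctrine.{u, v, w} R) (r : R) {X : D.C} (α : D.fib X) : D.fib X :=
  (D.mod r).app (op X) α

variable {D : GradedDoctrine.{u, v, w} R}

lemma re_bang (r : R) {X Y : D.C} (f : X ⟶ Y) (α : D.fib Y) :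
    D.re f (D.bang r α) = D.bang r (D.re f α) :=
  (ConcreteCategory.congr_hom ((D.mod r).naturality f.op) α).symm

lemma bang_mono (r : R) {X : D.C} {α β : D.fib X} (h : α ≤ β) : D.bang r α ≤ D.bang r β :=
  ((D.mod r).app (op X)).hom.monotone h

end GradedDoctrine

/-- An `R`-Lipschitz doctrine: an `R`-graded doctrine with a chosen distance `dist A` on every
object `A` of the base, satisfying graded substitutivity and independence of contexts. -/
structure LipschitzDoctrine (R : Type*) [ResourceSemiring R] extends
    GradedDoctrine.{u, v, w} R where
  dist : ∀ A : C, toDoctrine.fib (A ⊗ A)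
  isDistance : ∀ A : C, toLinearDoctrine.IsDistance A (dist A)
  subst : ∀ (A X : C) (α : toDoctrine.fib (X ⊗ A)), ∃ r : R,
    toDoctrine.re (lift (fst X (A ⊗ A)) (snd X (A ⊗ A) ≫ fst A A)) α *
        toGradedDoctrine.bang r (toDoctrine.re (snd X (A ⊗ A)) (dist A)) ≤
      toDoctrine.re (lift (fst X (A ⊗ A)) (snd X (A ⊗ A) ≫ snd A A)) α
  dist_prod : ∀ A X : C, dist (A ⊗ X) = toLinearDoctrine.boxDist (dist A) (dist X)
  dist_le_fst : ∀ A X : C, dist (A ⊗ X) ≤ toDoctrine.re (fst A X ⊗ₘ fst A X) (dist A)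
  dist_le_snd : ∀ A X : C, dist (A ⊗ X) ≤ toDoctrine.re (snd A X ⊗ₘ snd A X) (dist X)
  dist_unit : dist (𝟙_ C) = 1

/-- A functor between categories with chosen finite products preserves them strictly. -/
structure StrictlyPreservesProducts {C D : Type*} [Category* C] [Category* D]
    [CartesianMonoidalCategory C] [CartesianMonoidalCategory D] (F : C ⥤ D) : Prop where
  unit : F.obj (𝟙_ C) = 𝟙_ D
  prod (A B : C) : F.obj (A ⊗ B) = F.obj A ⊗ F.obj B
  map_fst (A B : C) : F.map (fst A B) = eqToHom (prod A B) ≫ fst (F.obj A) (F.obj B)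
  map_snd (A B : C) : F.map (snd A B) = eqToHom (prod A B) ≫ snd (F.obj A) (F.obj B)

lemma StrictlyPreservesProducts.id (C : Type*) [Category* C] [CartesianMonoidalCategory C] :
    StrictlyPreservesProducts (𝟭 C) :=
  ⟨rfl, fun _ _ => rfl, fun _ _ => by simp, fun _ _ => by simp⟩

lemma StrictlyPreservesProducts.comp {C D E : Type*} [Category* C] [Category* D] [Category* E]
    [CartesianMonoidalCategory C] [CartesianMonoidalCategory D] [CartesianMonoidalCategory E]
    {F : C ⥤ D} {G : D ⥤ E} (hF : StrictlyPreservesProducts F)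
    (hG : StrictlyPreservesProducts G) : StrictlyPreservesProducts (F ⋙ G) where
  unit := by rw [Functor.comp_obj, hF.unit, hG.unit]
  prod A B := by rw [Functor.comp_obj, hF.prod, hG.prod]; rfl
  map_fst A B := by simp [hF.map_fst, hG.map_fst, eqToHom_map]
  map_snd A B := by simp [hF.map_snd, hG.map_snd, eqToHom_map]

/-- The identification `F A × F B = F (A × B)`. -/
def StrictlyPreservesProducts.iso {C D : Type*} [Category* C] [Category* D]
    [CartesianMonoidalCategory C] [CartesianMonoidalCategory D] {F : C ⥤ D}
    (hF : StrictlyPreservesProducts F) (A B : C) : F.obj A ⊗ F.obj B ⟶ F.obj (A ⊗ B) :=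
  eqToHom (hF.prod A B).symm

end Doctrines

namespace GradedDoctrine

variable {R : Type*} [ResourceSemiring R]

/-- The component at `X` of a natural transformation `f : P ⟶ F.op ⋙ Q`. -/
def natApp {P : GradedDoctrine.{u, v, w} R} {Q : GradedDoctrine.{u', v', w} R} {F : P.C ⥤ Q.C}
    (f : P.P ⟶ F.op ⋙ Q.P) {X : P.C} (α : P.fib X) : Q.fib (F.obj X) := f.app (op X) α

/-- A 1-arrow of `R`-graded doctrines: a (strictly) finite product preserving functor `F` and a
natural transformation `f : P ⟶ F.op ⋙ Q` preserving the monoid structure and the modalities. -/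
structure Hom (P : GradedDoctrine.{u, v, w} R) (Q : GradedDoctrine.{u', v', w} R) where
  F : P.C ⥤ Q.C
  strict : StrictlyPreservesProducts F
  f : P.P ⟶ F.op ⋙ Q.P
  map_mul : ∀ {X : P.C} (α β : P.fib X),
    natApp f (α * β) = natApp f α * natApp f β
  map_one : ∀ X : P.C, natApp f (1 : P.fib X) = 1
  map_mod : ∀ (r : R) {X : P.C} (α : P.fib X),
    natApp f (P.bang r α) = Q.bang r (natApp f α)

namespace Hom

/-- The component of the natural transformation of a 1-arrow. -/
def app {P : GradedDoctrine.{u, v, w} R} {Q : GradedDoctrine.{u', v', w} R} (φ : Hom P Q)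
    {X : P.C} (α : P.fib X) : Q.fib (φ.F.obj X) := natApp φ.f α

variable {P : GradedDoctrine.{u, v, w} R} {Q : GradedDoctrine.{u', v', w} R}
  {S : GradedDoctrine.{u'', v'', w} R}

lemma app_re (φ : Hom P Q) {X Y : P.C} (g : X ⟶ Y) (α : P.fib Y) :
    φ.app (P.re g α) = Q.re (φ.F.map g) (φ.app α) :=
  ConcreteCategory.congr_hom (φ.f.naturality g.op) α

lemma app_mono (φ : Hom P Q) {X : P.C} {α β : P.fib X} (h : α ≤ β) : φ.app α ≤ φ.app β :=
  (φ.f.app (op X)).hom.monotone h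

lemma app_mul (φ : Hom P Q) {X : P.C} (α β : P.fib X) : φ.app (α * β) = φ.app α * φ.app β :=
  φ.map_mul α β

lemma app_one (φ : Hom P Q) (X : P.C) : φ.app (1 : P.fib X) = 1 := φ.map_one X

lemma app_bang (φ : Hom P Q) (r : R) {X : P.C} (α : P.fib X) :
    φ.app (P.bang r α) = Q.bang r (φ.app α) := φ.map_mod r α

variable (P) in
/-- The identity 1-arrow. -/
def id : Hom P P where
  F := 𝟭 P.C
  strict := .id _
  f := { app := fun _ => 𝟙 _ }
  map_mul _ _ := rfl
  map_one _ := rfl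
  map_mod _ _ _ := rfl

/-- Composition of 1-arrows. -/
def comp (φ : Hom P Q) (ψ : Hom Q S) : Hom P S where
  F := φ.F ⋙ ψ.F
  strict := φ.strict.comp ψ.strict
  f :=
    { app := fun X => φ.f.app X ≫ ψ.f.app (op (φ.F.obj X.unop))
      naturality := fun X Y g => by
        have h1 := φ.f.naturality g
        have h2 := ψ.f.naturality (φ.F.map g.unop).op
        dsimp at h1 h2 ⊢
        rw [reassoc_of% h1, h2, Category.assoc] }
  map_mul α β := (congrArg (ψ.app) (φ.map_mul α β)).trans (ψ.map_mul _ _)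
  map_one X := (congrArg (ψ.app) (φ.map_one X)).trans (ψ.map_one _)
  map_mod r _ α := (congrArg (ψ.app) (φ.map_mod r α)).trans (ψ.map_mod r _)

@[simp] lemma comp_app (φ : Hom P Q) (ψ : Hom Q S) {X : P.C} (α : P.fib X) :
    (φ.comp ψ).app α = ψ.app (φ.app α) := rfl

@[simp] lemma id_app {X : P.C} (α : P.fib X) : (id P).app α = α := rfl

lemma ext_data {φ ψ : Hom P Q} (hobj : ∀ X, φ.F.obj X = ψ.F.obj X)
    (hmap : ∀ {X Y : P.C} (g : X ⟶ Y),
      φ.F.map g = eqToHom (hobj X) ≫ ψ.F.map g ≫ eqToHom (hobj Y).symm)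
    (happ : ∀ {X : P.C} (α : P.fib X), φ.app α = Q.re (eqToHom (hobj X)) (ψ.app α)) : φ = ψ := by
  have hF : φ.F = ψ.F := CategoryTheory.Functor.ext hobj (fun _ _ g => hmap g)
  obtain ⟨F, hs, f, h1, h2, h3⟩ := φ
  obtain ⟨G, hs', g, h1', h2', h3'⟩ := ψ
  dsimp only at hF
  subst hF
  congr
  ext X α
  simpa [app, natApp, Doctrine.re] using happ (X := X.unop) α

/-- The image of an element over `A × A`, as an element over `F A × F A = F (A × A)`. -/
def distMap (φ : Hom P Q) {A : P.C} (ρ : P.fib (MonoidalCategory.tensorObj A A)) :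
    Q.fib (MonoidalCategory.tensorObj (φ.F.obj A) (φ.F.obj A)) :=
  Q.re (φ.strict.iso A A) (φ.app ρ)

lemma distMap_id {A : P.C} (ρ : P.fib (MonoidalCategory.tensorObj A A)) :
    (id P).distMap ρ = ρ := Doctrine.re_id _

lemma distMap_comp (φ : Hom P Q) (ψ : Hom Q S) {A : P.C}
    (ρ : P.fib (MonoidalCategory.tensorObj A A)) :
    (φ.comp ψ).distMap ρ = ψ.distMap (φ.distMap ρ) := by
  change S.re (eqToHom _) (ψ.app (φ.app ρ)) =
    S.re (eqToHom _) (ψ.app (Q.re (eqToHom _) (φ.app ρ)))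
  rw [app_re, ← Doctrine.re_comp, eqToHom_map]
  exact congrArg (fun g => S.re g (ψ.app (φ.app ρ))) (eqToHom_trans _ _).symm

end Hom

/-- A 2-arrow `(F, f) ⟶ (G, g)`: a natural transformation `θ : F ⟶ G` with
`f_X ≤ Q(θ_X) ∘ g_X` for all `X`. -/
structure Hom₂ {P : GradedDoctrine.{u, v, w} R} {Q : GradedDoctrine.{u', v', w} R}
    (φ ψ : Hom P Q) where
  θ : φ.F ⟶ ψ.F
  ineq : ∀ {X : P.C} (α : P.fib X), φ.app α ≤ Q.re (θ.app X) (ψ.app α)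

instance : CategoryStruct (GradedDoctrine.{u, v, w} R) where
  Hom P Q := Hom P Q
  id P := Hom.id P
  comp φ ψ := Hom.comp φ ψ

section

variable {P Q S : GradedDoctrine.{u, v, w} R}

instance : Category (P ⟶ Q) where
  Hom φ ψ := Hom₂ φ ψ
  id φ := ⟨𝟙 φ.F, fun _ => by simp⟩
  comp {φ ψ χ} a b := ⟨a.θ ≫ b.θ, fun α => by
    rw [NatTrans.comp_app, Doctrine.re_comp]
    exact (a.ineq α).trans (Doctrine.re_mono _ (b.ineq α))⟩

/-- Vertical composition of 2-arrows. -/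
def compHom₂ {φ ψ χ : P ⟶ Q} (a : φ ⟶ ψ) (b : ψ ⟶ χ) : φ ⟶ χ := a ≫ b

lemma hom₂_ext {φ ψ : P ⟶ Q} {a b : φ ⟶ ψ} (h : ∀ X, a.θ.app X = b.θ.app X) : a = b := by
  obtain ⟨a, _⟩ := a
  obtain ⟨b, _⟩ := b
  obtain rfl : a = b := by ext X; exact h X
  rfl

@[simp] lemma id_θ (φ : P ⟶ Q) : Hom₂.θ (𝟙 φ) = 𝟙 φ.F := rfl
@[simp] lemma comp_θ {φ ψ χ : P ⟶ Q} (a : φ ⟶ ψ) (b : ψ ⟶ χ) :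
    Hom₂.θ (a ≫ b) = a.θ ≫ b.θ := rfl

lemma eqToHom_θ {φ ψ : P ⟶ Q} (h : φ = ψ) (X : P.C) :
    (Hom₂.θ (eqToHom h)).app X = eqToHom (by rw [h]) := by subst h; rfl

lemma hcomp_assoc {T : GradedDoctrine.{u, v, w} R} (φ : P ⟶ Q) (ψ : Q ⟶ S) (χ : S ⟶ T) :
    (φ ≫ ψ) ≫ χ = φ ≫ ψ ≫ χ := rfl
lemma hid_comp (φ : P ⟶ Q) : 𝟙 P ≫ φ = φ := rfl
lemma hcomp_id (φ : P ⟶ Q) : φ ≫ 𝟙 Q = φ := rfl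

lemma id_comp_id {C : Type*} [Category* C] {X Y : C} (f : X ⟶ Y) : 𝟙 X ≫ f ≫ 𝟙 Y = f := by simp

/-- Whiskering. -/
def whiskerL (φ : P ⟶ Q) {ψ χ : Q ⟶ S} (a : ψ ⟶ χ) : φ ≫ ψ ⟶ φ ≫ χ :=
  Hom₂.mk (φ := φ ≫ ψ) (ψ := φ ≫ χ) (Functor.whiskerLeft φ.F a.θ) (fun α => a.ineq (φ.app α))

/-- Whiskering. -/
def whiskerR {φ ψ : P ⟶ Q} (a : φ ⟶ ψ) (χ : Q ⟶ S) : φ ≫ χ ⟶ ψ ≫ χ :=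
  Hom₂.mk (φ := φ ≫ χ) (ψ := ψ ≫ χ) (Functor.whiskerRight a.θ χ.F) (fun α =>
    (χ.app_mono (a.ineq α)).trans_eq (χ.app_re _ _))

end

/-- The 2-category of `R`-graded doctrines. -/
instance : Bicategory (GradedDoctrine.{u, v, w} R) where
  homCategory _ _ := inferInstance
  whiskerLeft φ _ _ a := whiskerL φ a
  whiskerRight a χ := whiskerR a χ
  associator φ ψ χ := Iso.refl (φ ≫ ψ ≫ χ)
  leftUnitor φ := Iso.refl φ
  rightUnitor φ := Iso.refl φ
  whiskerLeft_id φ ψ := hom₂_ext fun X => rfl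
  whiskerLeft_comp φ _ _ _ a b := hom₂_ext fun X => rfl
  id_whiskerRight φ ψ := hom₂_ext fun X => ψ.F.map_id _
  comp_whiskerRight a b χ := hom₂_ext fun X => χ.F.map_comp _ _
  id_whiskerLeft a := hom₂_ext fun X => (id_comp_id _).symm
  comp_whiskerLeft φ ψ _ _ a := hom₂_ext fun X => (id_comp_id _).symm
  whiskerRight_id a := hom₂_ext fun X => (id_comp_id _).symm
  whiskerRight_comp a φ ψ := hom₂_ext fun X => (id_comp_id _).symm
  whisker_assoc φ _ _ a ψ := hom₂_ext fun X => (id_comp_id _).symm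
  whisker_exchange {_ _ _ _ _ _ _} a b := hom₂_ext fun X => ((Hom₂.θ b).naturality _).symm
  pentagon φ ψ χ ω := hom₂_ext fun X =>
    (congrArg₂ (· ≫ ·) (ω.F.map_id _) (Category.comp_id _)).trans rfl
  triangle φ ψ := hom₂_ext fun X => (Category.comp_id _).trans (ψ.F.map_id _).symm

instance : Bicategory.Strict (GradedDoctrine.{u, v, w} R) where
  id_comp := hid_comp
  comp_id := hcomp_id
  assoc := hcomp_assoc
  leftUnitor_eqToIso _ := rfl
  rightUnitor_eqToIso _ := rfl
  associator_eqToIso _ _ _ := rfl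

end GradedDoctrine

namespace LipschitzDoctrine

variable {R : Type*} [ResourceSemiring R]

/-- A 1-arrow of `R`-Lipschitz doctrines: a 1-arrow of the underlying `R`-graded doctrines
preserving the distances. -/
@[ext]
structure Hom (P Q : LipschitzDoctrine.{u, v, w} R) where
  toHom : P.toGradedDoctrine ⟶ Q.toGradedDoctrine
  map_dist : ∀ A : P.C, Q.dist (toHom.F.obj A) = GradedDoctrine.Hom.distMap toHom (P.dist A)


namespace Hom

/-- The identity 1-arrow. -/
def id (P : LipschitzDoctrine.{u, v, w} R) : Hom P P where
  toHom := 𝟙 P.toGradedDoctrine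
  map_dist A := (GradedDoctrine.Hom.distMap_id _).symm

/-- Composition of 1-arrows. -/
def comp {P Q S : LipschitzDoctrine.{u, v, w} R} (φ : Hom P Q) (ψ : Hom Q S) : Hom P S where
  toHom := φ.toHom ≫ ψ.toHom
  map_dist A := by
    refine (ψ.map_dist _).trans ?_
    rw [φ.map_dist]
    exact (GradedDoctrine.Hom.distMap_comp _ _ _).symm

end Hom

instance : CategoryStruct (LipschitzDoctrine.{u, v, w} R) where
  Hom P Q := Hom P Q
  id P := Hom.id P
  comp φ ψ := Hom.comp φ ψ

section

variable {P Q S : LipschitzDoctrine.{u, v, w} R}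

/-- The 2-arrows between 1-arrows of `R`-Lipschitz doctrines are those between the underlying
1-arrows of `R`-graded doctrines. -/
instance : Category (P ⟶ Q) where
  Hom φ ψ := Hom.toHom φ ⟶ Hom.toHom ψ
  id φ := 𝟙 (Hom.toHom φ)
  comp a b := GradedDoctrine.compHom₂ a b
  id_comp a := Category.id_comp (obj := P.toGradedDoctrine ⟶ Q.toGradedDoctrine) a
  comp_id a := Category.comp_id (obj := P.toGradedDoctrine ⟶ Q.toGradedDoctrine) a
  assoc a b c := Category.assoc (obj := P.toGradedDoctrine ⟶ Q.toGradedDoctrine) a b c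

end

open GradedDoctrine in
/-- The 2-category of `R`-Lipschitz doctrines. -/
instance : Bicategory (LipschitzDoctrine.{u, v, w} R) where
  homCategory _ _ := inferInstance
  whiskerLeft φ _ _ a := whiskerL (Hom.toHom φ) a
  whiskerRight a χ := whiskerR a (Hom.toHom χ)
  associator φ ψ χ := Iso.refl (φ ≫ ψ ≫ χ)
  leftUnitor φ := Iso.refl φ
  rightUnitor φ := Iso.refl φ
  whiskerLeft_id φ ψ := hom₂_ext fun X => rfl
  whiskerLeft_comp φ _ _ _ a b := hom₂_ext fun X => rfl
  id_whiskerRight φ ψ := hom₂_ext fun X => (Hom.toHom ψ).F.map_id _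
  comp_whiskerRight a b χ := hom₂_ext fun X => (Hom.toHom χ).F.map_comp _ _
  id_whiskerLeft a := hom₂_ext fun X => (id_comp_id _).symm
  comp_whiskerLeft φ ψ _ _ a := hom₂_ext fun X => (id_comp_id _).symm
  whiskerRight_id a := hom₂_ext fun X => (id_comp_id _).symm
  whiskerRight_comp a φ ψ := hom₂_ext fun X => (id_comp_id _).symm
  whisker_assoc φ _ _ a ψ := hom₂_ext fun X => (id_comp_id _).symm
  whisker_exchange {_ _ _ _ _ _ _} a b := hom₂_ext fun X => ((Hom₂.θ b).naturality _).symm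
  pentagon φ ψ χ ω := hom₂_ext fun X =>
    (congrArg₂ (· ≫ ·) ((Hom.toHom ω).F.map_id _) (Category.comp_id _)).trans rfl
  triangle φ ψ := hom₂_ext fun X => (Category.comp_id _).trans ((Hom.toHom ψ).F.map_id _).symm

instance : Bicategory.Strict (LipschitzDoctrine.{u, v, w} R) where
  id_comp _ := rfl
  comp_id _ := rfl
  assoc _ _ _ := rfl
  leftUnitor_eqToIso _ := rfl
  rightUnitor_eqToIso _ := rfl
  associator_eqToIso _ _ _ := rfl

variable (R) in
/-- The forgetful 2-functor from `R`-Lipschitz doctrines to `R`-graded doctrines. -/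
def forget : StrictPseudofunctor (LipschitzDoctrine.{u, v, w} R) (GradedDoctrine.{u, v, w} R) :=
  StrictPseudofunctor.mk''
    { obj := fun P => P.toGradedDoctrine
      map := fun φ => Hom.toHom φ
      map₂ := fun a => a
      map₂_id := fun _ => rfl
      map₂_comp := fun _ _ => rfl
      map_id := fun _ => rfl
      map_comp := fun _ _ => rfl
      map₂_whisker_left := fun _ _ _ _ => (GradedDoctrine.id_comp_id _).symm
      map₂_whisker_right := fun _ _ => (GradedDoctrine.id_comp_id _).symm }

end LipschitzDoctrine

section Completion

open MonoidalCategory CartesianMonoidalCategory LinearDoctrine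

variable {R : Type*} [ResourceSemiring R]

namespace LinearDoctrine

variable {D : LinearDoctrine.{u, v, w}}

lemma IsDistance.refl' {A : D.C} {ρ : D.fib (A ⊗ A)} (h : IsDistance A ρ) {X : D.C} (a : X ⟶ A) :
    1 ≤ D.re (lift a a) ρ := by
  have := Doctrine.re_mono a h.refl
  rwa [D.re_one, ← Doctrine.re_comp, comp_lift, Category.comp_id] at this

lemma IsDistance.symm' {A : D.C} {ρ : D.fib (A ⊗ A)} (h : IsDistance A ρ) {X : D.C}
    (a b : X ⟶ A) : D.re (lift a b) ρ ≤ D.re (lift b a) ρ := by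
  have := Doctrine.re_mono (lift a b) h.symm
  rwa [← Doctrine.re_comp, comp_lift, lift_fst, lift_snd] at this

lemma IsDistance.trans' {A : D.C} {ρ : D.fib (A ⊗ A)} (h : IsDistance A ρ) {X : D.C}
    (a b c : X ⟶ A) : D.re (lift a b) ρ * D.re (lift b c) ρ ≤ D.re (lift a c) ρ := by
  have := Doctrine.re_mono (lift a (lift b c)) h.trans
  simpa only [D.re_mul, ← Doctrine.re_comp, comp_lift, lift_fst, lift_snd, lift_snd_assoc]
    using this

lemma IsDistance.mk' {A : D.C} {ρ : D.fib (A ⊗ A)}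
    (refl : 1 ≤ D.re (lift (𝟙 A) (𝟙 A)) ρ)
    (symm : ∀ {X : D.C} (a b : X ⟶ A), D.re (lift a b) ρ ≤ D.re (lift b a) ρ)
    (trans : ∀ {X : D.C} (a b c : X ⟶ A),
      D.re (lift a b) ρ * D.re (lift b c) ρ ≤ D.re (lift a c) ρ) : IsDistance A ρ where
  refl := refl
  symm := by simpa using symm (fst A A) (snd A A)
  trans := trans _ _ _

lemma re_boxDist {A B X : D.C} (ρ : D.fib (A ⊗ A)) (σ : D.fib (B ⊗ B)) (a a' : X ⟶ A)
    (b b' : X ⟶ B) :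
    D.re (lift (lift a b) (lift a' b')) (boxDist ρ σ) =
      D.re (lift a a') ρ * D.re (lift b b') σ := by
  simp [boxDist, D.re_mul, ← Doctrine.re_comp]

lemma re_boxDist' {A B X : D.C} (ρ : D.fib (A ⊗ A)) (σ : D.fib (B ⊗ B)) (a a' : X ⟶ A ⊗ B) :
    D.re (lift a a') (boxDist ρ σ) =
      D.re (lift (a ≫ fst _ _) (a' ≫ fst _ _)) ρ * D.re (lift (a ≫ snd _ _) (a' ≫ snd _ _)) σ := by
  simp [boxDist, D.re_mul, ← Doctrine.re_comp]

lemma IsDistance.box {A B : D.C} {ρ : D.fib (A ⊗ A)} {σ : D.fib (B ⊗ B)} (hρ : IsDistance A ρ)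
    (hσ : IsDistance B σ) : IsDistance (A ⊗ B) (boxDist ρ σ) := by
  refine .mk' ?_ (fun a b => ?_) (fun a b c => ?_)
  · rw [re_boxDist']
    exact one_le_mul (hρ.refl' _) (hσ.refl' _)
  · simp only [re_boxDist']
    exact mul_le_mul' (hρ.symm' _ _) (hσ.symm' _ _)
  · simp only [re_boxDist']
    rw [mul_mul_mul_comm]
    exact mul_le_mul' (hρ.trans' _ _ _) (hσ.trans' _ _ _)

lemma re_le_one {X Y : D.C} (f : X ⟶ Y) {α : D.fib Y} (h : IsAffine α) : D.re f α ≤ 1 :=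
  (Doctrine.re_mono f h).trans_eq (D.re_one f)

lemma IsAffine.box {A B : D.C} {ρ : D.fib (A ⊗ A)} {σ : D.fib (B ⊗ B)} (hρ : IsAffine ρ)
    (hσ : IsAffine σ) : IsAffine (boxDist ρ σ) :=
  mul_le_one' (re_le_one _ hρ) (re_le_one _ hσ)

lemma isDistance_one (A : D.C) : IsDistance A (1 : D.fib (A ⊗ A)) where
  refl := (D.re_one _).ge
  symm := (D.re_one _).ge
  trans := by simp [D.re_one]

end LinearDoctrine

/-- Objects of the base of the Lipschitz completion: objects with an affine distance. -/
structure Met (P : GradedDoctrine.{u, v, w} R) where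
  A : P.C
  ρ : P.fib (A ⊗ A)
  isDistance : IsDistance A ρ
  affine : IsAffine ρ

namespace Met

variable {P : GradedDoctrine.{u, v, w} R}

/-- `r` tracks the arrow `f` from `(A, ρ)` to `(B, σ)`. -/
def Tracks (X Y : Met P) (r : R) (f : X.A ⟶ Y.A) : Prop := P.bang r X.ρ ≤ P.re (f ⊗ₘ f) Y.ρ

/-- Arrows of the base of the Lipschitz completion: arrows tracked by some grade. -/
@[ext]
structure Hom (X Y : Met P) where
  f : X.A ⟶ Y.A
  tracked : ∃ r : R, Tracks X Y r f

instance : Category (Met P) where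
  Hom X Y := Hom X Y
  id X := ⟨𝟙 X.A, 1, by
    rw [Tracks, id_tensorHom_id, Doctrine.re_id]; exact P.mod_one X.ρ⟩
  comp {X Y Z} f g := ⟨f.f ≫ g.f, by
    obtain ⟨r, hr⟩ := f.tracked
    obtain ⟨s, hs⟩ := g.tracked
    refine ⟨s * r, (P.mod_mul_grade s r X.ρ).trans
      ((GradedDoctrine.bang_mono s hr).trans ?_)⟩
    rw [← GradedDoctrine.re_bang, ← tensorHom_comp_tensorHom, Doctrine.re_comp]
    exact Doctrine.re_mono _ hs⟩

@[ext]
lemma hom_ext {X Y : Met P} {f g : X ⟶ Y} (h : f.f = g.f) : f = g := Hom.ext h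

@[simp] lemma id_f (X : Met P) : Hom.f (𝟙 X) = 𝟙 X.A := rfl
@[simp] lemma comp_f {X Y Z : Met P} (f : X ⟶ Y) (g : Y ⟶ Z) : Hom.f (f ≫ g) = f.f ≫ g.f := rfl

variable (P) in
/-- The functor forgetting distances. -/
@[simps]
def U : Met P ⥤ P.C where
  obj X := X.A
  map f := f.f

lemma eqToHom_f {X Y : Met P} (h : X = Y) :
    Hom.f (eqToHom h) = eqToHom (congrArg Met.A h) := by subst h; rfl

variable (P) in
/-- The terminal object `(1, κ)`. -/
def one : Met P := ⟨𝟙_ P.C, 1, isDistance_one _, le_rfl⟩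

/-- The product `(A × B, ρ ⊠ σ)`. -/
def prod (X Y : Met P) : Met P :=
  ⟨X.A ⊗ Y.A, boxDist X.ρ Y.ρ, X.isDistance.box Y.isDistance, X.affine.box Y.affine⟩

def toOne (X : Met P) : X ⟶ one P :=
  ⟨toUnit X.A, 0, (P.mod_zero X.ρ).trans_eq (P.re_one _).symm⟩

def prodFst (X Y : Met P) : prod X Y ⟶ X :=
  ⟨fst X.A Y.A, 1, (P.mod_one _).trans (mul_le_of_le_one_right' (re_le_one _ Y.affine))⟩

def prodSnd (X Y : Met P) : prod X Y ⟶ Y :=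
  ⟨snd X.A Y.A, 1, (P.mod_one _).trans (mul_le_of_le_one_left' (re_le_one _ X.affine))⟩

def prodLift {X Y Z : Met P} (f : Z ⟶ X) (g : Z ⟶ Y) : Z ⟶ prod X Y :=
  ⟨lift f.f g.f, by
    obtain ⟨r, hr⟩ := f.tracked
    obtain ⟨s, hs⟩ := g.tracked
    refine ⟨r + s, (P.mod_add r s Z.ρ).trans ((mul_le_mul' hr hs).trans_eq ?_)⟩
    simp [prod, boxDist, P.re_mul, ← Doctrine.re_comp]⟩

/-- The (chosen) finite products of the base of the Lipschitz completion. -/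
instance : CartesianMonoidalCategory (Met P) :=
  .ofChosenFiniteProducts
    ⟨Limits.asEmptyCone (one P), Limits.IsTerminal.ofUniqueHom toOne
      (fun _ _ => hom_ext (toUnit_unique _ _))⟩
    (fun X Y => ⟨Limits.BinaryFan.mk (prodFst X Y) (prodSnd X Y),
      Limits.BinaryFan.IsLimit.mk _ prodLift
        (fun _ _ => hom_ext (lift_fst _ _)) (fun _ _ => hom_ext (lift_snd _ _))
        (fun _ _ _ h₁ h₂ => hom_ext (CartesianMonoidalCategory.hom_ext _ _
          ((congrArg Hom.f h₁).trans (lift_fst _ _).symm)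
          ((congrArg Hom.f h₂).trans (lift_snd _ _).symm)))⟩)

lemma tensor_eq (X Y : Met P) : X ⊗ Y = prod X Y := rfl
lemma fst_f (X Y : Met P) : Hom.f (fst X Y) = fst X.A Y.A := rfl
lemma snd_f (X Y : Met P) : Hom.f (snd X Y) = snd X.A Y.A := rfl
lemma lift_f {X Y Z : Met P} (f : Z ⟶ X) (g : Z ⟶ Y) : Hom.f (lift f g) = lift f.f g.f :=
  CartesianMonoidalCategory.hom_ext _ _
    ((congrArg Hom.f (lift_fst f g)).trans (lift_fst _ _).symm)
    ((congrArg Hom.f (lift_snd f g)).trans (lift_snd _ _).symm)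
lemma tensorHom_f {X Y X' Y' : Met P} (f : X ⟶ X') (g : Y ⟶ Y') :
    Hom.f (f ⊗ₘ g) = f.f ⊗ₘ g.f :=
  CartesianMonoidalCategory.hom_ext _ _
    ((congrArg Hom.f (tensorHom_fst f g)).trans (tensorHom_fst _ _).symm)
    ((congrArg Hom.f (tensorHom_snd f g)).trans (tensorHom_snd _ _).symm)

/-- `r` tracks the element `α` over `A` with respect to `ρ`. -/
def TracksElem (X : Met P) (r : R) (α : P.fib X.A) : Prop :=
  P.re (fst X.A X.A) α * P.bang r X.ρ ≤ P.re (snd X.A X.A) α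

lemma TracksElem.re {X : Met P} {r : R} {α : P.fib X.A} (h : TracksElem X r α) {Z : P.C}
    (a b : Z ⟶ X.A) : P.re a α * P.bang r (P.re (lift a b) X.ρ) ≤ P.re b α := by
  have := Doctrine.re_mono (lift a b) h
  rwa [P.re_mul, GradedDoctrine.re_bang, ← Doctrine.re_comp, ← Doctrine.re_comp, lift_fst,
    lift_snd] at this

/-- The `R`-graded descent data over `(A, ρ)`. -/
def Des (X : Met P) : Submonoid (P.fib X.A) where
  carrier := {α | ∃ r : R, TracksElem X r α}
  one_mem' := ⟨0, by
    rw [TracksElem, P.re_one, P.re_one, one_mul]; exact P.mod_zero X.ρ⟩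
  mul_mem' := by
    rintro α β ⟨r, hr⟩ ⟨s, hs⟩
    refine ⟨r + s, ?_⟩
    rw [TracksElem, P.re_mul, P.re_mul]
    refine (mul_le_mul' le_rfl (P.mod_add r s X.ρ)).trans ?_
    rw [mul_mul_mul_comm]
    exact mul_le_mul' hr hs

lemma re_mem_Des {X Y : Met P} (f : X ⟶ Y) {β : P.fib Y.A} (hβ : β ∈ Des Y) :
    P.re f.f β ∈ Des X := by
  obtain ⟨r, hr⟩ := f.tracked
  obtain ⟨s, hs⟩ := hβ
  refine ⟨s * r, ?_⟩
  rw [TracksElem, ← Doctrine.re_comp, ← Doctrine.re_comp]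
  refine (mul_le_mul' le_rfl ((P.mod_mul_grade s r X.ρ).trans
      (GradedDoctrine.bang_mono s hr))).trans ?_
  have := hs.re (fst X.A X.A ≫ f.f) (snd X.A X.A ≫ f.f)
  rwa [lift_fst_comp_snd_comp] at this

lemma bang_mem_Des {X : Met P} (r : R) {α : P.fib X.A} (hα : α ∈ Des X) :
    P.bang r α ∈ Des X := by
  obtain ⟨s, hs⟩ := hα
  refine ⟨r * s, ?_⟩
  rw [TracksElem, GradedDoctrine.re_bang, GradedDoctrine.re_bang]
  exact (mul_le_mul' le_rfl (P.mod_mul_grade r s X.ρ)).trans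
    ((P.mod_mul r _ _).trans (GradedDoctrine.bang_mono r hs))

variable (P) in
/-- The fibres of the Lipschitz completion. -/
def fibres : (Met P)ᵒᵖ ⥤ PartOrd.{w} where
  obj X := PartOrd.of (Des X.unop)
  map f := PartOrd.ofHom
    { toFun := fun β => ⟨P.re f.unop.f β.1, re_mem_Des f.unop β.2⟩
      monotone' := fun _ _ h => Doctrine.re_mono _ h }
  map_id X := by
    ext β
    exact Doctrine.re_id (D := P.toDoctrine) (X := X.unop.A) β.1
  map_comp f g := by
    ext β
    exact Doctrine.re_comp (D := P.toDoctrine) g.unop.f f.unop.f β.1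

variable (P) in
/-- The primary linear doctrine underlying the Lipschitz completion. -/
def linear : LinearDoctrine.{max u w, v, w} where
  C := Met P
  P := fibres P
  mon X := inferInstanceAs (CommMonoid (Des X))
  ordMon X := inferInstanceAs (IsOrderedMonoid (Des X))
  re_mul {X _} f α β := by
    refine Subtype.ext (p := (· ∈ Des X)) ?_
    exact P.re_mul (Hom.f f) α.1 β.1
  re_one {X _} f := by
    refine Subtype.ext (p := (· ∈ Des X)) ?_
    exact P.re_one (Hom.f f)

variable (P) in
/-- The `R`-graded doctrine underlying the Lipschitz completion. -/
def graded : GradedDoctrine.{max u w, v, w} R where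
  toLinearDoctrine := linear P
  mod r :=
    { app := fun X => PartOrd.ofHom
        { toFun := fun α => ⟨P.bang r α.1, bang_mem_Des r α.2⟩
          monotone' := fun _ _ h => GradedDoctrine.bang_mono r h }
      naturality := fun X Y f => by
        ext α; exact Subtype.ext (GradedDoctrine.re_bang r _ _).symm }
  one_le_mod r X := P.one_le_mod r X.A
  mod_mul r _ α β := P.mod_mul r α.1 β.1
  mod_zero α := P.mod_zero α.1
  mod_add r s _ α := P.mod_add r s α.1
  mod_one α := P.mod_one α.1
  mod_mul_grade r s _ α := P.mod_mul_grade r s α.1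
  mod_anti h _ α := P.mod_anti h α.1

/-- An element of `P(A)` which is a descent datum, as an element of the completion. -/
def mkFib {X : (graded P).C} (α : P.fib (Met.A X)) (h : α ∈ Des X) : (graded P).fib X := ⟨α, h⟩

/-- The underlying element of a descent datum. -/
def val {X : (graded P).C} (α : (graded P).fib X) : P.fib (Met.A X) := α.1

lemma val_mem {X : (graded P).C} (α : (graded P).fib X) : val α ∈ Des X := α.2
lemma val_re {X Y : (graded P).C} (f : X ⟶ Y) (α : (graded P).fib Y) :
    val ((graded P).re f α) = P.re (Hom.f f) (val α) := rfl
lemma val_mul {X : (graded P).C} (α β : (graded P).fib X) : val (α * β) = val α * val β := rfl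
lemma val_one (X : (graded P).C) : val (1 : (graded P).fib X) = 1 := rfl
lemma val_bang (r : R) {X : (graded P).C} (α : (graded P).fib X) :
    val ((graded P).bang r α) = P.bang r (val α) := rfl
lemma le_iff {X : (graded P).C} (α β : (graded P).fib X) : α ≤ β ↔ val α ≤ val β := Iff.rfl
lemma val_ext {X : (graded P).C} {α β : (graded P).fib X} (h : val α = val β) : α = β :=
  Subtype.ext (p := (· ∈ Des X)) h

lemma dist_mem_Des (X : Met P) : X.ρ ∈ Des (X ⊗ X) := by
  refine ⟨1, (mul_le_mul' le_rfl (P.mod_one _)).trans ?_⟩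
  let Z : P.C := (X.A ⊗ X.A) ⊗ (X.A ⊗ X.A)
  let p : Z ⟶ X.A ⊗ X.A := fst _ _
  let q : Z ⟶ X.A ⊗ X.A := snd _ _
  change P.re p X.ρ * boxDist X.ρ X.ρ ≤ P.re q X.ρ
  have hp : P.re p X.ρ = P.re (lift (p ≫ fst _ _) (p ≫ snd _ _)) X.ρ := by
    rw [← comp_lift, lift_fst_snd, Category.comp_id]
  have hq : P.re q X.ρ = P.re (lift (q ≫ fst _ _) (q ≫ snd _ _)) X.ρ := by
    rw [← comp_lift, lift_fst_snd, Category.comp_id]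
  have hb : boxDist X.ρ X.ρ = P.re (lift (p ≫ fst _ _) (q ≫ fst _ _)) X.ρ *
      P.re (lift (p ≫ snd _ _) (q ≫ snd _ _)) X.ρ := by
    rw [← re_boxDist', lift_fst_snd, Doctrine.re_id]
  rw [hp, hq, hb]
  have h1 := X.isDistance.symm' (p ≫ fst _ _) (q ≫ fst _ _)
  have h2 := X.isDistance.trans' (q ≫ fst _ _) (p ≫ fst _ _) (p ≫ snd _ _)
  have h3 := X.isDistance.trans' (q ≫ fst _ _) (p ≫ snd _ _) (q ≫ snd _ _)
  refine le_trans ?_ ((mul_le_mul' h2 le_rfl).trans h3)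
  rw [mul_left_comm, mul_assoc]
  exact mul_le_mul' h1 le_rfl

/-- The distance of the Lipschitz completion on `(A, ρ)` is `ρ`. -/
def dist (X : (graded P).C) : (graded P).fib (X ⊗ X) := mkFib (Met.ρ X) (dist_mem_Des X)

lemma val_dist (X : (graded P).C) : val (dist X) = Met.ρ X := rfl

lemma re_lift_f {X Y Z : Met P} (a : Z ⟶ X) (b : Z ⟶ Y) (α : P.fib (X.A ⊗ Y.A)) :
    P.re (Hom.f (lift a b) : Z.A ⟶ X.A ⊗ Y.A) α = P.re (lift a.f b.f) α :=
  congrArg (fun g => P.re g α) (lift_f a b)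

lemma re_tensorHom_f {X Y X' Y' : Met P} (a : X ⟶ X') (b : Y ⟶ Y') (α : P.fib (X'.A ⊗ Y'.A)) :
    P.re (Hom.f (a ⊗ₘ b) : X.A ⊗ Y.A ⟶ X'.A ⊗ Y'.A) α = P.re (a.f ⊗ₘ b.f) α :=
  congrArg (fun g => P.re g α) (tensorHom_f a b)

lemma dist_isDistance (X : (graded P).C) :
    IsDistance (D := (graded P).toLinearDoctrine) X (dist X) where
  refl := X.isDistance.refl.trans_eq (re_lift_f (𝟙 X) (𝟙 X) X.ρ).symm
  symm := X.isDistance.symm.trans_eq (re_lift_f (snd X X) (fst X X) X.ρ).symm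
  trans := by
    have h := X.isDistance.trans
    have h1 := re_lift_f (P := P) (fst X (X ⊗ X)) (snd X (X ⊗ X) ≫ fst X X) X.ρ
    have h2 := re_lift_f (P := P) (snd X (X ⊗ X) ≫ fst X X) (snd X (X ⊗ X) ≫ snd X X) X.ρ
    have h3 := re_lift_f (P := P) (fst X (X ⊗ X)) (snd X (X ⊗ X) ≫ snd X X) X.ρ
    exact (mul_le_mul' h1.le h2.le).trans (h.trans h3.ge)

lemma dist_prod (X Y : (graded P).C) :
    dist (X ⊗ Y) = boxDist (D := (graded P).toLinearDoctrine) (dist X) (dist Y) :=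
  val_ext (congrArg₂ (· * ·) (re_tensorHom_f (P := P) (fst X Y) (fst X Y) X.ρ).symm
    (re_tensorHom_f (P := P) (snd X Y) (snd X Y) Y.ρ).symm)

lemma dist_subst (A X : (graded P).C) (α : (graded P).fib (X ⊗ A)) : ∃ r : R,
    (graded P).re (lift (fst X (A ⊗ A)) (snd X (A ⊗ A) ≫ fst A A)) α *
        (graded P).bang r ((graded P).re (snd X (A ⊗ A)) (dist A)) ≤
      (graded P).re (lift (fst X (A ⊗ A)) (snd X (A ⊗ A) ≫ snd A A)) α := by
  obtain ⟨r, hr⟩ := val_mem α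
  refine ⟨r, ?_⟩
  have h1 := re_lift_f (P := P) (fst X (A ⊗ A)) (snd X (A ⊗ A) ≫ fst A A) (val α)
  have h2 := re_lift_f (P := P) (fst X (A ⊗ A)) (snd X (A ⊗ A) ≫ snd A A) (val α)
  have h3 := TracksElem.re hr (lift (fst X.A (A.A ⊗ A.A)) (snd X.A (A.A ⊗ A.A) ≫ fst A.A A.A))
    (lift (fst X.A (A.A ⊗ A.A)) (snd X.A (A.A ⊗ A.A) ≫ snd A.A A.A))
  have h4 : P.re (lift (lift (fst X.A (A.A ⊗ A.A)) (snd X.A (A.A ⊗ A.A) ≫ fst A.A A.A))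
      (lift (fst X.A (A.A ⊗ A.A)) (snd X.A (A.A ⊗ A.A) ≫ snd A.A A.A))) (boxDist X.ρ A.ρ) =
      P.re (lift (fst X.A (A.A ⊗ A.A)) (fst X.A (A.A ⊗ A.A))) X.ρ *
        P.re (snd X.A (A.A ⊗ A.A)) A.ρ := by
    rw [re_boxDist, ← comp_lift, lift_fst_snd, Category.comp_id]
  have h5 := GradedDoctrine.bang_mono r
    ((le_mul_of_one_le_left' (X.isDistance.refl' _)).trans_eq h4.symm)
  exact (mul_le_mul' h1.le h5).trans (h3.trans h2.ge)

end Met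

/-- The Lipschitz completion of an `R`-graded doctrine. -/
def lipCompletion (P : GradedDoctrine.{u, v, w} R) : LipschitzDoctrine.{max u w, v, w} R where
  toGradedDoctrine := Met.graded P
  dist := Met.dist
  isDistance := Met.dist_isDistance
  subst := Met.dist_subst
  dist_prod := Met.dist_prod
  dist_le_fst X Y := by
    refine (Met.dist_prod X Y).trans_le ?_
    exact mul_le_of_le_one_right' (re_le_one (D := (Met.graded P).toLinearDoctrine) _ Y.affine)
  dist_le_snd X Y := by
    refine (Met.dist_prod X Y).trans_le ?_
    exact mul_le_of_le_one_left' (re_le_one (D := (Met.graded P).toLinearDoctrine) _ X.affine)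
  dist_unit := rfl

namespace StrictlyPreservesProducts

variable {C D : Type*} [Category* C] [Category* D]
    [CartesianMonoidalCategory C] [CartesianMonoidalCategory D] {F : C ⥤ D}
    (hF : StrictlyPreservesProducts F)

lemma iso_fst (A B : C) : hF.iso A B ≫ F.map (fst A B) = fst _ _ := by
  simp [iso, hF.map_fst]

lemma iso_snd (A B : C) : hF.iso A B ≫ F.map (snd A B) = snd _ _ := by
  simp [iso, hF.map_snd]

lemma hom_ext (hF : StrictlyPreservesProducts F) {A B : C} {X : D} {g h : X ⟶ F.obj (A ⊗ B)}
    (h₁ : g ≫ F.map (fst A B) = h ≫ F.map (fst A B))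
    (h₂ : g ≫ F.map (snd A B) = h ≫ F.map (snd A B)) : g = h := by
  rw [hF.map_fst] at h₁
  rw [hF.map_snd] at h₂
  rw [← cancel_mono (eqToHom (hF.prod A B))]
  ext
  · simpa using h₁
  · simpa using h₂

lemma lift_iso {A B : C} {X : C} {Y : D} (g : Y ⟶ F.obj X) (a : X ⟶ A) (b : X ⟶ B) :
    lift (g ≫ F.map a) (g ≫ F.map b) ≫ hF.iso A B = g ≫ F.map (lift a b) := by
  apply hF.hom_ext
  · rw [Category.assoc, iso_fst, lift_fst, Category.assoc, ← F.map_comp, lift_fst]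
  · rw [Category.assoc, iso_snd, lift_snd, Category.assoc, ← F.map_comp, lift_snd]

lemma iso_natural {A A' B B' : C} (a : A ⟶ A') (b : B ⟶ B') :
    hF.iso A B ≫ F.map (a ⊗ₘ b) = (F.map a ⊗ₘ F.map b) ≫ hF.iso A' B' := by
  apply hF.hom_ext
  · rw [Category.assoc, Category.assoc, iso_fst, ← F.map_comp, tensorHom_fst, tensorHom_fst,
      F.map_comp, ← Category.assoc, iso_fst]
  · rw [Category.assoc, Category.assoc, iso_snd, ← F.map_comp, tensorHom_snd, tensorHom_snd,
      F.map_comp, ← Category.assoc, iso_snd]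

lemma iso_natTrans {G : C ⥤ D} (hG : StrictlyPreservesProducts G) (θ : F ⟶ G) (A B : C) :
    hF.iso A B ≫ θ.app (A ⊗ B) = (θ.app A ⊗ₘ θ.app B) ≫ hG.iso A B := by
  apply hG.hom_ext
  · rw [Category.assoc, Category.assoc, iso_fst, ← θ.naturality, tensorHom_fst,
      ← Category.assoc, iso_fst]
  · rw [Category.assoc, Category.assoc, iso_snd, ← θ.naturality, tensorHom_snd,
      ← Category.assoc, iso_snd]

end StrictlyPreservesProducts

namespace GradedDoctrine.Hom

variable {P : GradedDoctrine.{u, v, w} R} {Q : GradedDoctrine.{u', v', w} R} (φ : Hom P Q)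

lemma re_lift_distMap {A X : P.C} {Y : Q.C} (g : Y ⟶ φ.F.obj X) (a b : X ⟶ A)
    (ρ : P.fib (A ⊗ A)) :
    Q.re (lift (g ≫ φ.F.map a) (g ≫ φ.F.map b)) (φ.distMap ρ) =
      Q.re g (φ.app (P.re (lift a b) ρ)) := by
  rw [distMap, ← Doctrine.re_comp, φ.strict.lift_iso, Doctrine.re_comp, app_re]

lemma re_tensorHom_distMap {A X : P.C} (a : X ⟶ A) (ρ : P.fib (A ⊗ A)) :
    φ.distMap (P.re (a ⊗ₘ a) ρ) = Q.re (φ.F.map a ⊗ₘ φ.F.map a) (φ.distMap ρ) := by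
  rw [distMap, distMap, app_re, ← Doctrine.re_comp, φ.strict.iso_natural, Doctrine.re_comp]

lemma distMap_mono {A : P.C} {ρ σ : P.fib (A ⊗ A)} (h : ρ ≤ σ) : φ.distMap ρ ≤ φ.distMap σ :=
  Doctrine.re_mono _ (φ.app_mono h)

lemma distMap_mul {A : P.C} (ρ σ : P.fib (A ⊗ A)) :
    φ.distMap (ρ * σ) = φ.distMap ρ * φ.distMap σ := by
  rw [distMap, app_mul, Q.re_mul]; rfl

lemma distMap_one (A : P.C) : φ.distMap (1 : P.fib (A ⊗ A)) = 1 := by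
  rw [distMap, app_one, Q.re_one]

lemma distMap_bang (r : R) {A : P.C} (ρ : P.fib (A ⊗ A)) :
    φ.distMap (P.bang r ρ) = Q.bang r (φ.distMap ρ) := by
  rw [distMap, app_bang, GradedDoctrine.re_bang]; rfl

lemma distMap_re_fst {A : P.C} (α : P.fib A) :
    φ.distMap (P.re (fst A A) α) = Q.re (fst _ _) (φ.app α) := by
  rw [distMap, app_re, ← Doctrine.re_comp, φ.strict.iso_fst]

lemma distMap_re_snd {A : P.C} (α : P.fib A) :
    φ.distMap (P.re (snd A A) α) = Q.re (snd _ _) (φ.app α) := by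
  rw [distMap, app_re, ← Doctrine.re_comp, φ.strict.iso_snd]

lemma distMap_isDistance {A : P.C} {ρ : P.fib (A ⊗ A)} (h : IsDistance A ρ) :
    IsDistance (φ.F.obj A) (φ.distMap ρ) where
  refl := by
    have h1 := φ.re_lift_distMap (𝟙 _) (𝟙 A) (𝟙 A) ρ
    rw [φ.F.map_id, Category.comp_id, Doctrine.re_id] at h1
    rw [h1, ← φ.app_one]
    exact φ.app_mono h.refl
  symm := by
    have h1 := φ.re_lift_distMap (φ.strict.iso A A) (snd A A) (fst A A) ρ
    rw [φ.strict.iso_fst, φ.strict.iso_snd] at h1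
    rw [h1]
    exact φ.distMap_mono h.symm
  trans := by
    let g : φ.F.obj A ⊗ (φ.F.obj A ⊗ φ.F.obj A) ⟶ φ.F.obj (A ⊗ (A ⊗ A)) :=
      (φ.F.obj A ◁ φ.strict.iso A A) ≫ φ.strict.iso A (A ⊗ A)
    have g1 : g ≫ φ.F.map (fst A (A ⊗ A)) = fst _ _ := by
      rw [Category.assoc, φ.strict.iso_fst, whiskerLeft_fst]
    have g2 : g ≫ φ.F.map (snd A (A ⊗ A) ≫ fst A A) = snd _ _ ≫ fst _ _ := by
      rw [φ.F.map_comp, ← Category.assoc, Category.assoc _ (φ.strict.iso _ _), φ.strict.iso_snd,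
        whiskerLeft_snd, Category.assoc, φ.strict.iso_fst]
    have g3 : g ≫ φ.F.map (snd A (A ⊗ A) ≫ snd A A) = snd _ _ ≫ snd _ _ := by
      rw [φ.F.map_comp, ← Category.assoc, Category.assoc _ (φ.strict.iso _ _), φ.strict.iso_snd,
        whiskerLeft_snd, Category.assoc, φ.strict.iso_snd]
    rw [← g1, ← g2, ← g3, re_lift_distMap, re_lift_distMap, re_lift_distMap, ← Q.re_mul,
      ← app_mul]
    exact Doctrine.re_mono _ (φ.app_mono h.trans)

lemma distMap_isAffine {A : P.C} {ρ : P.fib (A ⊗ A)} (h : IsAffine ρ) :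
    IsAffine (φ.distMap ρ) :=
  (φ.distMap_mono h).trans_eq (φ.distMap_one A)

end GradedDoctrine.Hom

namespace Met

variable {P : GradedDoctrine.{u, v, w} R} {Q : GradedDoctrine.{u', v', w} R}

lemma ext_data {X Y : Met P} (h : X.A = Y.A)
    (hρ : X.ρ = P.re (eqToHom h ⊗ₘ eqToHom h) Y.ρ) : X = Y := by
  obtain ⟨A, ρ, _, _⟩ := X
  obtain ⟨B, σ, _, _⟩ := Y
  dsimp only at h
  subst h
  congr
  simpa using hρ

lemma mk_ext {A : P.C} {ρ σ : P.fib (A ⊗ A)} (h : ρ = σ) (h₁ : IsDistance A ρ) (h₂ : IsAffine ρ)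
    (h₁' : IsDistance A σ) (h₂' : IsAffine σ) : (⟨A, ρ, h₁, h₂⟩ : Met P) = ⟨A, σ, h₁', h₂'⟩ := by
  subst h; rfl

/-- The functor between the bases of the Lipschitz completions induced by a 1-arrow. -/
def mapBase (φ : GradedDoctrine.Hom P Q) : Met P ⥤ Met Q where
  obj X := ⟨φ.F.obj X.A, φ.distMap X.ρ, φ.distMap_isDistance X.isDistance,
    φ.distMap_isAffine X.affine⟩
  map f := ⟨φ.F.map f.f, by
    obtain ⟨r, hr⟩ := f.tracked
    refine ⟨r, ?_⟩
    have h := φ.distMap_mono hr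
    rwa [φ.distMap_bang, φ.re_tensorHom_distMap] at h⟩
  map_id X := Met.hom_ext (φ.F.map_id _)
  map_comp f g := Met.hom_ext (φ.F.map_comp _ _)

lemma mapBase_prod (φ : GradedDoctrine.Hom P Q) (X Y : Met P) :
    (mapBase φ).obj (X ⊗ Y) = (mapBase φ).obj X ⊗ (mapBase φ).obj Y := by
  refine ext_data (φ.strict.prod X.A Y.A) ?_
  change φ.distMap (boxDist X.ρ Y.ρ) =
    Q.re (eqToHom (φ.strict.prod X.A Y.A) ⊗ₘ eqToHom (φ.strict.prod X.A Y.A))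
      (boxDist (φ.distMap X.ρ) (φ.distMap Y.ρ))
  rw [boxDist, boxDist, φ.distMap_mul, φ.re_tensorHom_distMap, φ.re_tensorHom_distMap, Q.re_mul,
    ← Doctrine.re_comp, ← Doctrine.re_comp, tensorHom_comp_tensorHom, tensorHom_comp_tensorHom,
    φ.strict.map_fst, φ.strict.map_snd]

lemma mapBase_strict (φ : GradedDoctrine.Hom P Q) : StrictlyPreservesProducts (mapBase φ) where
  unit := ext_data (X := (mapBase φ).obj (one P)) (Y := one Q) φ.strict.unit
    ((φ.distMap_one _).trans (Q.re_one _).symm)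
  prod := mapBase_prod φ
  map_fst X Y := Met.hom_ext <| by
    rw [comp_f, eqToHom_f]; exact φ.strict.map_fst X.A Y.A
  map_snd X Y := Met.hom_ext <| by
    rw [comp_f, eqToHom_f]; exact φ.strict.map_snd X.A Y.A

lemma app_mem_Des (φ : GradedDoctrine.Hom P Q) {X : Met P} {α : P.fib X.A} (h : α ∈ Des X) :
    φ.app α ∈ Des ((mapBase φ).obj X) := by
  obtain ⟨r, hr⟩ := h
  refine ⟨r, ?_⟩
  have h := φ.distMap_mono hr
  rwa [φ.distMap_mul, φ.distMap_bang, φ.distMap_re_fst, φ.distMap_re_snd] at h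

/-- The action of the Lipschitz completion on 1-arrows, as a 1-arrow of graded doctrines. -/
def mapGraded (φ : GradedDoctrine.Hom P Q) : GradedDoctrine.Hom (graded P) (graded Q) where
  F := mapBase φ
  strict := mapBase_strict φ
  f :=
    { app := fun X => PartOrd.ofHom
        { toFun := fun α => ⟨φ.app α.1, app_mem_Des φ α.2⟩
          monotone' := fun _ _ h => φ.app_mono h }
      naturality := fun X Y g => by
        ext α
        exact val_ext (X := (mapBase φ).obj Y.unop) (φ.app_re (Hom.f g.unop) α.1) }
  map_mul α β := val_ext (φ.app_mul (val α) (val β))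
  map_one X := val_ext (φ.app_one _)
  map_mod r _ α := val_ext (φ.app_bang r (val α))

lemma val_mapGraded_app (φ : GradedDoctrine.Hom P Q) {X : (graded P).C} (α : (graded P).fib X) :
    val ((mapGraded φ).app α) = φ.app (val α) := rfl

lemma mapGraded_dist (φ : GradedDoctrine.Hom P Q) (X : (graded P).C) :
    dist ((mapGraded φ).F.obj X) = (mapGraded φ).distMap (dist X) := by
  refine val_ext (congrArg (fun g => Q.re g (φ.app X.ρ)) ?_)
  exact (eqToHom_f (mapBase_prod φ X X).symm).symm

lemma mapGraded_id (P : GradedDoctrine.{u, v, w} R) :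
    mapGraded (GradedDoctrine.Hom.id P) = GradedDoctrine.Hom.id (graded P) := by
  have hobj (X : Met P) : (mapBase (GradedDoctrine.Hom.id P)).obj X = X :=
    mk_ext (GradedDoctrine.Hom.distMap_id X.ρ) _ _ _ _
  refine GradedDoctrine.Hom.ext_data hobj (fun {X Y} g => ?_) (fun {X} α => ?_)
  · refine Met.hom_ext ?_
    refine Eq.trans ?_ (congrArg₂ (fun a b => a ≫ Hom.f g ≫ b) (eqToHom_f (hobj X)).symm
      (eqToHom_f (hobj Y).symm).symm)
    exact (GradedDoctrine.id_comp_id _).symm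
  · refine val_ext ?_
    exact (congrArg (fun a => P.re a (val α)) (eqToHom_f (hobj X))).trans
      (Doctrine.re_id (val α)) |>.symm

lemma mapGraded_comp {S : GradedDoctrine.{u'', v'', w} R} (φ : GradedDoctrine.Hom P Q)
    (ψ : GradedDoctrine.Hom Q S) :
    mapGraded (φ.comp ψ) = (mapGraded φ).comp (mapGraded ψ) := by
  have hobj (X : Met P) : (mapBase (φ.comp ψ)).obj X = (mapBase ψ).obj ((mapBase φ).obj X) :=
    mk_ext (GradedDoctrine.Hom.distMap_comp φ ψ X.ρ) _ _ _ _
  refine GradedDoctrine.Hom.ext_data hobj (fun {X Y} g => ?_) (fun {X} α => ?_)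
  · refine Met.hom_ext ?_
    refine Eq.trans ?_ (congrArg₂ (fun a b => a ≫ ψ.F.map (φ.F.map (Hom.f g)) ≫ b)
      (eqToHom_f (hobj X)).symm (eqToHom_f (hobj Y).symm).symm)
    exact (GradedDoctrine.id_comp_id _).symm
  · refine val_ext ?_
    exact (congrArg (fun a => S.re a (ψ.app (φ.app (val α)))) (eqToHom_f (hobj X))).trans
      (Doctrine.re_id _) |>.symm

/-- The action of the Lipschitz completion on 2-arrows. -/
def mapGraded₂ {φ ψ : GradedDoctrine.Hom P Q} (a : GradedDoctrine.Hom₂ φ ψ) :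
    GradedDoctrine.Hom₂ (mapGraded φ) (mapGraded ψ) where
  θ :=
    { app := fun X => Hom.mk (X := (mapBase φ).obj X) (Y := (mapBase ψ).obj X) (a.θ.app (Met.A X))
        ⟨1, by
          refine (Q.mod_one _).trans ?_
          change φ.distMap (Met.ρ X) ≤
            Q.re (a.θ.app (Met.A X) ⊗ₘ a.θ.app (Met.A X)) (ψ.distMap (Met.ρ X))
          rw [GradedDoctrine.Hom.distMap, GradedDoctrine.Hom.distMap, ← Doctrine.re_comp,
            ← φ.strict.iso_natTrans ψ.strict, Doctrine.re_comp]
          exact Doctrine.re_mono _ (a.ineq _)⟩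
      naturality := fun X Y g => Met.hom_ext (a.θ.naturality (Hom.f g)) }
  ineq α := a.ineq (val α)

end Met

/-- The action of the Lipschitz completion on 1-arrows. -/
def lipMap {P Q : GradedDoctrine.{max u w, v, w} R} (φ : P ⟶ Q) :
    lipCompletion.{max u w, v, w} P ⟶ lipCompletion.{max u w, v, w} Q :=
  LipschitzDoctrine.Hom.mk (P := lipCompletion P) (Q := lipCompletion Q)
    (Met.mapGraded φ) (Met.mapGraded_dist φ)

/-- The action of the Lipschitz completion on 2-arrows. -/
def lipMap₂ {P Q : GradedDoctrine.{max u w, v, w} R} {φ ψ : P ⟶ Q} (a : φ ⟶ ψ) :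
    lipMap.{u, v, w} φ ⟶ lipMap.{u, v, w} ψ := Met.mapGraded₂ a

lemma lipMap_id (P : GradedDoctrine.{max u w, v, w} R) : lipMap.{u, v, w} (𝟙 P) = 𝟙 _ :=
  LipschitzDoctrine.Hom.ext (Met.mapGraded_id P)

lemma lipMap_comp {P Q S : GradedDoctrine.{max u w, v, w} R} (φ : P ⟶ Q) (ψ : Q ⟶ S) :
    lipMap.{u, v, w} (φ ≫ ψ) = lipMap.{u, v, w} φ ≫ lipMap.{u, v, w} ψ :=
  LipschitzDoctrine.Hom.ext (Met.mapGraded_comp φ ψ)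

lemma lipCompletion_eqToHom {P : LipschitzDoctrine.{max u w, v, w} R}
    {Q : GradedDoctrine.{max u w, v, w} R} {φ ψ : P ⟶ lipCompletion.{max u w, v, w} Q}
    (h : φ = ψ) (X : P.C) :
    Met.Hom.f (P := Q) ((GradedDoctrine.Hom₂.θ (eqToHom h)).app X) =
      eqToHom (congrArg (fun χ => Met.A (P := Q) ((LipschitzDoctrine.Hom.toHom χ).F.obj X)) h) := by
  subst h; rfl

variable (R) in
/-- The Lipschitz completion 2-functor from `R`-graded doctrines to `R`-Lipschitz doctrines. -/
def completion :
    StrictPseudofunctor (GradedDoctrine.{max u w, v, w} R)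
      (LipschitzDoctrine.{max u w, v, w} R) :=
  StrictPseudofunctor.mk''
    { obj := fun P => lipCompletion.{max u w, v, w} P
      map := fun φ => lipMap.{u, v, w} φ
      map₂ := fun a => lipMap₂.{u, v, w} a
      map₂_id := fun _ => rfl
      map₂_comp := fun _ _ => rfl
      map_id := fun P => lipMap_id.{u, v, w} P
      map_comp := fun φ ψ => lipMap_comp.{u, v, w} φ ψ
      map₂_whisker_left := fun φ ψ χ a => by
        refine GradedDoctrine.hom₂_ext fun X => Met.hom_ext ?_
        refine Eq.trans ?_ (congrArg₂ (fun s t => s ≫ a.θ.app (φ.F.obj (Met.A X)) ≫ t)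
          (lipCompletion_eqToHom.{u, v, w} (lipMap_comp.{u, v, w} φ ψ) X).symm
          (lipCompletion_eqToHom.{u, v, w} (lipMap_comp.{u, v, w} φ χ).symm X).symm)
        exact (GradedDoctrine.id_comp_id _).symm
      map₂_whisker_right := fun {_ _ _ φ ψ} a χ => by
        refine GradedDoctrine.hom₂_ext fun X => Met.hom_ext ?_
        refine Eq.trans ?_ (congrArg₂ (fun s t => s ≫ χ.F.map (a.θ.app (Met.A X)) ≫ t)
          (lipCompletion_eqToHom.{u, v, w} (lipMap_comp.{u, v, w} φ χ) X).symm
          (lipCompletion_eqToHom.{u, v, w} (lipMap_comp.{u, v, w} ψ χ).symm X).symm)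
        exact (GradedDoctrine.id_comp_id _).symm }

/-- The 1-arrow from the Lipschitz completion of `P` to `P` which forgets the distances on the
base and is the inclusion on the fibres. -/
def lipCounit (P : GradedDoctrine.{u, v, w} R) : GradedDoctrine.Hom (Met.graded P) P where
  F := Met.U P
  strict := ⟨rfl, fun _ _ => rfl, fun _ _ => (Category.id_comp _).symm,
    fun _ _ => (Category.id_comp _).symm⟩
  f :=
    { app := fun X => PartOrd.ofHom
        { toFun := fun α => α.1
          monotone' := fun _ _ h => h }
      naturality := fun X Y g => by ext α; rfl }
  map_mul _ _ := rfl
  map_one _ := rfl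
  map_mod _ _ _ := rfl

namespace LipschitzDoctrine

variable (Q : LipschitzDoctrine.{u, v, w} R)

lemma dist_affine (A : Q.C) : IsAffine (Q.dist A) := by
  have h1 : Q.dist (A ⊗ 𝟙_ Q.C) = Q.re (fst A (𝟙_ Q.C) ⊗ₘ fst A (𝟙_ Q.C)) (Q.dist A) := by
    rw [Q.dist_prod, boxDist, Q.dist_unit, Q.re_one, mul_one]
  have h2 := Q.dist_le_snd A (𝟙_ Q.C)
  rw [h1, Q.dist_unit, Q.re_one] at h2
  have h3 := Doctrine.re_mono (lift (𝟙 A) (toUnit A) ⊗ₘ lift (𝟙 A) (toUnit A)) h2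
  rwa [← Doctrine.re_comp, tensorHom_comp_tensorHom, lift_fst, id_tensorHom_id, Doctrine.re_id,
    Q.re_one] at h3

/-- The object `(A, δ_A)`. -/
def toMet (A : Q.C) : Met Q.toGradedDoctrine := ⟨A, Q.dist A, Q.isDistance A, Q.dist_affine A⟩

lemma subst' {A X : Q.C} (α : Q.fib (X ⊗ A)) : ∃ r : R, ∀ {Z : Q.C} (x : Z ⟶ X) (a b : Z ⟶ A),
    Q.re (lift x a) α * Q.bang r (Q.re (lift a b) (Q.dist A)) ≤ Q.re (lift x b) α := by
  obtain ⟨r, hr⟩ := Q.subst A X α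
  refine ⟨r, fun x a b => ?_⟩
  have := Doctrine.re_mono (lift x (lift a b)) hr
  simpa only [Q.re_mul, GradedDoctrine.re_bang, ← Doctrine.re_comp, comp_lift, lift_fst, lift_snd,
    lift_snd_assoc] using this

lemma exists_tracks {A B : Q.C} (f : A ⟶ B) : ∃ r : R, Met.Tracks (Q.toMet A) (Q.toMet B) r f := by
  obtain ⟨r, hr⟩ := Q.subst' (Q.re (f ⊗ₘ f) (Q.dist B))
  refine ⟨r, ?_⟩
  have h := hr (fst A A) (fst A A) (snd A A)
  rw [lift_fst_snd, Doctrine.re_id, Doctrine.re_id, ← Doctrine.re_comp, lift_map] at h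
  exact (le_mul_of_one_le_left' ((Q.isDistance B).refl' _)).trans h

lemma exists_tracksElem {A : Q.C} (α : Q.fib A) : α ∈ Met.Des (Q.toMet A) := by
  obtain ⟨r, hr⟩ := Q.subst' (Q.re (snd (𝟙_ Q.C) A) α)
  refine ⟨r, ?_⟩
  have h := hr (toUnit _) (fst A A) (snd A A)
  rw [lift_fst_snd, Doctrine.re_id, ← Doctrine.re_comp, ← Doctrine.re_comp, lift_snd,
    lift_snd] at h
  exact h

/-- The functor `A ↦ (A, δ_A)`, the identity on arrows. -/
def toMetFunctor : Q.C ⥤ Met Q.toGradedDoctrine where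
  obj A := Q.toMet A
  map f := ⟨f, Q.exists_tracks f⟩

lemma toMet_prod (A B : Q.C) : Q.toMet (A ⊗ B) = Q.toMet A ⊗ Q.toMet B :=
  Met.mk_ext (Q.dist_prod A B) _ _ _ _

end LipschitzDoctrine

/-- The 1-arrow from an `R`-Lipschitz doctrine to the Lipschitz completion of the underlying
`R`-graded doctrine, which sends `A` to `(A, δ_A)` and is the identity on arrows and fibres. -/
def lipUnit (Q : LipschitzDoctrine.{max u w, v, w} R) :
    LipschitzDoctrine.Hom Q (lipCompletion.{max u w, v, w} Q.toGradedDoctrine) where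
  toHom :=
    { F := Q.toMetFunctor
      strict :=
        { unit := Met.mk_ext Q.dist_unit _ _ _ _
          prod := Q.toMet_prod
          map_fst := fun A B => Met.hom_ext <| by
            refine Eq.trans ?_ (congrArg (fun a => a ≫ fst A B)
              (Met.eqToHom_f (Q.toMet_prod A B)).symm)
            exact (Category.id_comp _).symm
          map_snd := fun A B => Met.hom_ext <| by
            refine Eq.trans ?_ (congrArg (fun a => a ≫ snd A B)
              (Met.eqToHom_f (Q.toMet_prod A B)).symm)
            exact (Category.id_comp _).symm }
      f :=
        { app := fun X => PartOrd.ofHom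
            { toFun := fun α => ⟨α, Q.exists_tracksElem (A := X.unop) α⟩
              monotone' := fun _ _ h => h }
          naturality := fun X Y g => by ext α; rfl }
      map_mul := fun _ _ => rfl
      map_one := fun _ => rfl
      map_mod := fun _ _ _ => rfl }
  map_dist A := by
    refine Met.val_ext ?_
    exact ((congrArg (fun g => Q.re g (Q.dist A))
      (Met.eqToHom_f (Q.toMet_prod A A).symm)).trans (Doctrine.re_id _)).symm

end Completion

end

end LipDoc

universe u v w t

/-! A Lipschitz doctrine is a graded doctrine `P` together with a section `s` of the forgetful
1-arrow `lipCounit P` from its completion.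

From a doctrine to a section: the product and unit axioms make every distance `dist A` affine
(`dist_affine`), substitutivity makes every arrow Lipschitz (`exists_tracks`) and every element a
descent datum (`exists_tracksElem`). So `A ↦ (A, dist A)`, the identity on arrows and fibres, is a
1-arrow into the completion. It is natural in `Q` because 1-arrows preserve distances
(`lipUnit_naturality`). Both triangle identities say that adding the distance and then forgetting a
distance changes nothing.

From a section to a doctrine: the counit law of a coalgebra says that `s` sends `A` to some `(A,
ρ_A)` and is the identity on arrows and fibres, so its only content is the family `ρ`. That `s`
lands in the completion is substitutivity: every `α` over `A` is a descent datum for `ρ_A`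
(`mem_Des_section`). Strict preservation of products is `ρ_{A × B} = ρ_A ⊠ ρ_B` and `ρ_1 = κ`
(`sectionObj_prod`, `sectionObj_unit`), and affineness gives the two projection inequalities. Hence
`sectionLipschitz`.

The two passages are mutually inverse (`dist_sectionLipschitz_lipUnit`, `lipUnit_sectionLipschitz`).
On objects, the square of a coalgebra morphism says that distances are preserved
(`distMap_section`). On 2-cells both 2-functors keep the underlying 2-arrow of graded doctrines.

What remains is bookkeeping with strict equalities: the counit law gives only a propositional
equality between `A` and the object under `s A`. Replacing that object by `A` itself (`Met.copy`)
makes both round trips fix the underlying graded doctrine definitionally, so that only distances or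
structure maps have to be compared. -/

namespace TwoCat

open CategoryTheory Bicategory

universe w₁ w₂ v₁ v₂ u₁ u₂

variable {B : Type u₁} [Bicategory.{w₁, v₁} B] {C : Type u₂} [Bicategory.{w₂, v₂} C]

/-! ### Equality of strict 2-functors and of coalgebra cells -/

/-- Two strict pseudofunctors are equal if they agree on objects, 1-cells and 2-cells. -/
lemma strictPseudofunctor_ext {F G : StrictPseudofunctor B C}
    (hobj : ∀ a, F.obj a = G.obj a)
    (hmap : ∀ {a b : B} (f : a ⟶ b), F.map f ≍ G.map f)
    (hmap₂ : ∀ {a b : B} {f g : a ⟶ b} (η : f ⟶ g), F.map₂ η ≍ G.map₂ η) : F = G := by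
  -- Strictness makes the unit and composition isomorphisms equal to `eqToIso`, hence determined by
  -- the action on 1-cells. This is recorded before the structures are taken apart.
  have hF₀ {a b c : B} (f : a ⟶ b) (g : b ⟶ c) := F.mapComp_eq_eqToIso f g
  have hG₀ {a b c : B} (f : a ⟶ b) (g : b ⟶ c) := G.mapComp_eq_eqToIso f g
  have hF₁ (a : B) := F.mapId_eq_eqToIso a
  have hG₁ (a : B) := G.mapId_eq_eqToIso a
  obtain ⟨⟨⟨⟨⟨⟨Fo, Fm⟩, Fm₂⟩, _, _⟩, Fi, Fc, _, _, _, _, _⟩, _, _⟩, _, _⟩ := F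
  obtain ⟨⟨⟨⟨⟨⟨Go, Gm⟩, Gm₂⟩, _, _⟩, Gi, Gc, _, _, _, _, _⟩, _, _⟩, _, _⟩ := G
  obtain rfl : Fo = Go := funext hobj
  obtain rfl : @Fm = @Gm := by
    funext a b f
    exact eq_of_heq (hmap f)
  obtain rfl : @Fm₂ = @Gm₂ := by
    funext a b f g η
    exact eq_of_heq (hmap₂ η)
  obtain rfl : Fi = Gi := by
    funext a
    exact (hF₁ a).trans (hG₁ a).symm
  obtain rfl : @Fc = @Gc := by
    funext a b c f g
    exact (hF₀ f g).trans (hG₀ f g).symm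
  rfl

namespace TwoComonad.Coalgebra

variable {G : TwoComonad C}

lemma ext_str {X : C} {s s' : X ⟶ G.T.obj X} (h : s = s') (h₁ h₂ h₁' h₂') :
    (⟨X, s, h₁, h₂⟩ : G.Coalgebra) = ⟨X, s', h₁', h₂'⟩ := by
  subst h; rfl

variable [Strict C]

/-- Coalgebras reached by different routes share their carriers definitionally and differ in their
structure maps only. Once these are identified, a morphism is determined by its underlying 1-cell.
-/
lemma hom_heq {X Y : C} {s s' : X ⟶ G.T.obj X} {t t' : Y ⟶ G.T.obj Y} (hs : s = s')
    (ht : t = t') {h₁ h₂ h₁' h₂' k₁ k₂ k₁' k₂'}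
    (φ : (⟨X, s, h₁, h₂⟩ : G.Coalgebra) ⟶ ⟨Y, t, k₁, k₂⟩)
    (φ' : (⟨X, s', h₁', h₂'⟩ : G.Coalgebra) ⟶ ⟨Y, t', k₁', k₂'⟩)
    (h : φ.f = φ'.f) : φ ≍ φ' := by
  subst hs ht
  exact heq_of_eq (Hom.ext h)

lemma hom₂_heq {X Y : C} {s s' : X ⟶ G.T.obj X} {t t' : Y ⟶ G.T.obj Y} (hs : s = s')
    (ht : t = t') {h₁ h₂ h₁' h₂' k₁ k₂ k₁' k₂'}
    {φ ψ : (⟨X, s, h₁, h₂⟩ : G.Coalgebra) ⟶ ⟨Y, t, k₁, k₂⟩}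
    {φ' ψ' : (⟨X, s', h₁', h₂'⟩ : G.Coalgebra) ⟶ ⟨Y, t', k₁', k₂'⟩}
    (hφ : φ.f = φ'.f) (hψ : ψ.f = ψ'.f) (α : φ ⟶ ψ) (α' : φ' ⟶ ψ')
    (h : α.η ≍ α'.η) : α ≍ α' := by
  subst hs ht
  obtain rfl : φ = φ' := Hom.ext hφ
  obtain rfl : ψ = ψ' := Hom.ext hψ
  exact heq_of_eq (hom₂_ext (eq_of_heq h))

end TwoComonad.Coalgebra

end TwoCat

namespace LipDoc

open CategoryTheory MonoidalCategory CartesianMonoidalCategory LinearDoctrine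

variable {R : Type t} [ResourceSemiring R]

/-! ### The 2-adjunction between the forgetful 2-functor and the completion -/

/-- The two composites send `A` to `FA` with the distance of `Q`, respectively with the image of the
distance of `P`. They agree exactly because `φ` preserves distances; on arrows and fibres both act
as `φ`. -/
lemma lipUnit_naturality {P Q : LipschitzDoctrine.{max u w, v, w} R} (φ : P ⟶ Q) :
    φ ≫ (lipUnit.{u, v, w} Q : Q ⟶ lipCompletion.{max u w, v, w} Q.toGradedDoctrine) =
      (lipUnit.{u, v, w} P : P ⟶ lipCompletion.{max u w, v, w} P.toGradedDoctrine) ≫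
        lipMap.{u, v, w} (LipschitzDoctrine.Hom.toHom φ) := by
  have hobj (A : P.C) : Q.toMet (φ.toHom.F.obj A) = (Met.mapBase φ.toHom).obj (P.toMet A) :=
    Met.mk_ext (φ.map_dist A) _ _ _ _
  refine LipschitzDoctrine.Hom.ext
    (GradedDoctrine.Hom.ext_data hobj (fun {X Y} g => ?_) (fun {X} α => ?_))
  -- An `eqToHom` between objects of the completion with the same underlying object lies over an
  -- identity, so it disappears after forgetting distances. The same device removes every later
  -- transport of this kind.
  · refine Met.hom_ext ?_
    refine Eq.trans ?_ (congrArg₂ (fun a b => a ≫ φ.toHom.F.map g ≫ b)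
      (Met.eqToHom_f (hobj X)).symm (Met.eqToHom_f (hobj Y).symm).symm)
    exact (GradedDoctrine.id_comp_id _).symm
  · refine Met.val_ext ?_
    exact (congrArg (fun a => Q.re a (φ.toHom.app α)) (Met.eqToHom_f (hobj X))).trans
      (Doctrine.re_id _) |>.symm

/-- Distances are discarded at the end of both composites, so no transport is needed and the
equality is definitional. -/
lemma lipCounit_naturality {P Q : GradedDoctrine.{max u w, v, w} R} (φ : P ⟶ Q) :
    (Met.mapGraded φ : Met.graded P ⟶ Met.graded Q) ≫
        (lipCounit.{max u w, v, w} Q : Met.graded Q ⟶ Q) =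
      (lipCounit.{max u w, v, w} P : Met.graded P ⟶ P) ≫ φ := rfl

variable (R) in
/-- The unit of the adjunction between the forgetful 2-functor and the Lipschitz completion. -/
def lipUnitTrans : TwoCat.TwoNatTrans
    (StrictPseudofunctor.id (LipschitzDoctrine.{max u w, v, w} R))
    ((LipschitzDoctrine.forget.{max u w, v, w} R).comp (completion.{u, v, w} R)) where
  app Q := lipUnit.{u, v, w} Q
  naturality φ := lipUnit_naturality φ
  naturality₂ {P Q φ ψ} a := by
    refine GradedDoctrine.hom₂_ext fun X => Met.hom_ext ?_
    refine Eq.trans ?_ (congrArg₂ (fun s t => s ≫ (GradedDoctrine.Hom₂.θ a).app X ≫ t)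
      (lipCompletion_eqToHom.{u, v, w} (lipUnit_naturality.{u, v, w} φ) X).symm
      (lipCompletion_eqToHom.{u, v, w} (lipUnit_naturality.{u, v, w} ψ).symm X).symm)
    exact (GradedDoctrine.id_comp_id _).symm

variable (R) in
/-- The counit of the adjunction between the forgetful 2-functor and the Lipschitz completion. -/
def lipCounitTrans : TwoCat.TwoNatTrans
    ((completion.{u, v, w} R).comp (LipschitzDoctrine.forget.{max u w, v, w} R))
    (StrictPseudofunctor.id (GradedDoctrine.{max u w, v, w} R)) where
  app P := lipCounit.{max u w, v, w} P
  naturality φ := lipCounit_naturality φ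
  naturality₂ _ := GradedDoctrine.hom₂_ext fun _ => (GradedDoctrine.id_comp_id _).symm

variable (R) in
/-- The 2-adjunction between the forgetful 2-functor and the Lipschitz completion. -/
def lipAdjunction : TwoCat.TwoAdjunction
    (LipschitzDoctrine.forget.{max u w, v, w} R) (completion.{u, v, w} R) where
  unit := lipUnitTrans.{u, v, w} R
  counit := lipCounitTrans.{u, v, w} R
  left_triangle Q := rfl
  right_triangle P := by
    have hobj (X : Met P) :
        (Met.mapBase (lipCounit P)).obj ((lipCompletion P).toMet X) = X :=
      -- The counit preserves products definitionally, so the image of the distance `X.ρ` is its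
      -- reindexing along an identity.
      Met.mk_ext (Doctrine.re_id X.ρ) _ _ _ _
    refine LipschitzDoctrine.Hom.ext
      (GradedDoctrine.Hom.ext_data hobj (fun {X Y} g => ?_) (fun {X} α => ?_))
    · refine Met.hom_ext ?_
      refine Eq.trans ?_ (congrArg₂ (fun a b => a ≫ Met.Hom.f g ≫ b)
        (Met.eqToHom_f (hobj X)).symm (Met.eqToHom_f (hobj Y).symm).symm)
      exact (GradedDoctrine.id_comp_id _).symm
    · refine Met.val_ext ?_
      exact (congrArg (fun a => P.re a (Met.val α)) (Met.eqToHom_f (hobj X))).trans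
        (Doctrine.re_id (Met.val α)) |>.symm

/-! ### Transport along equalities of objects and of 1-arrows -/

lemma eqToHom_conj_cancel {C : Type*} [Category* C] {X X' Y Y' : C} (h : X = X') (k : Y = Y')
    (g : X ⟶ Y) :
    eqToHom h ≫ (eqToHom h.symm ≫ g ≫ eqToHom k) ≫ eqToHom k.symm = g := by
  subst h k; simp

lemma Doctrine.re_eqToHom_cancel {D : Doctrine.{u, v, w}} {X Y : D.C} (h : X = Y) (α : D.fib X) :
    D.re (eqToHom h) (D.re (eqToHom h.symm) α) = α := by
  subst h; simp

namespace GradedDoctrine.Hom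

variable {P Q : GradedDoctrine.{u, v, w} R} {φ ψ : Hom P Q}

/-- With `congr_map` and `congr_app`, this is the converse of `ext_data`. Together they unpack the
counit law of a coalgebra into statements about objects, arrows and elements. -/
lemma congr_obj (h : φ = ψ) (X : P.C) : φ.F.obj X = ψ.F.obj X := by rw [h]

lemma congr_map (h : φ = ψ) {X Y : P.C} (g : X ⟶ Y) :
    φ.F.map g = eqToHom (congr_obj h X) ≫ ψ.F.map g ≫ eqToHom (congr_obj h Y).symm := by
  subst h; simp

lemma congr_app (h : φ = ψ) {X : P.C} (α : P.fib X) :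
    φ.app α = Q.re (eqToHom (congr_obj h X)) (ψ.app α) := by
  subst h; simp

end GradedDoctrine.Hom

namespace Met

variable {P : GradedDoctrine.{u, v, w} R}

/-- The object `X` of the base of the Lipschitz completion, with the underlying object replaced
by an equal one. -/
def copy (X : Met P) {A : P.C} (h : X.A = A) : Met P where
  A := A
  ρ := P.re (eqToHom h.symm ⊗ₘ eqToHom h.symm) X.ρ
  isDistance := by subst h; simpa using X.isDistance
  affine := by subst h; simpa using X.affine

lemma copy_eq (X : Met P) {A : P.C} (h : X.A = A) : X.copy h = X := ext_data h.symm rfl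

/-- Because the underlying object is literally the same on both sides, an equality in `Met P` yields
an honest equality of distances. Arranging for this is the purpose of `copy`. -/
lemma ρ_eq_of_eq {A : P.C} {ρ σ : P.fib (A ⊗ A)} {h₁ h₂ h₁' h₂'}
    (h : (⟨A, ρ, h₁, h₂⟩ : Met P) = ⟨A, σ, h₁', h₂'⟩) : ρ = σ := by
  injection h

end Met

/-! ### Sections of the counit as families of distances -/

namespace GradedDoctrine.Hom

variable {P : GradedDoctrine.{max u w, v, w} R} {s : Hom P (Met.graded P)}
  (hs : s.comp (lipCounit P) = Hom.id P)

/-- For a section `s` of the counit of the Lipschitz completion, the object `s A` with underlying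
object `A`. -/
def sectionObj (A : P.C) : Met P := Met.copy (s.F.obj A) (congr_obj hs A)

lemma sectionObj_eq (A : P.C) : sectionObj hs A = s.F.obj A := Met.copy_eq _ _

/-- This is the source of substitutivity. The element `s.app α` is a descent datum over `s A`, and
by the counit law it is `α` up to transport; reindexing along the equality between `sectionObj hs A`
and `s A` undoes the transport. -/
lemma mem_Des_section {A : P.C} (α : P.fib A) : α ∈ Met.Des (sectionObj hs A) := by
  have h : Met.val (s.app α) = _ := congr_app hs α
  have h' := Met.re_mem_Des (eqToHom (sectionObj_eq hs A)) (Met.val_mem (s.app α))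
  have hα : P.re (Met.Hom.f (eqToHom (sectionObj_eq hs A))) (Met.val (s.app α)) = α :=
    (congrArg₂ (fun a b => P.re a b) (Met.eqToHom_f (sectionObj_eq hs A)) h).trans
      (Doctrine.re_eqToHom_cancel (congr_obj hs A).symm α)
  exact hα ▸ h'

/-- The chosen product in the completion carries the distance `⊠`, so strict preservation of
products by `s` encodes the product axiom for the distances. -/
lemma sectionObj_prod (A B : P.C) :
    sectionObj hs (A ⊗ B) = sectionObj hs A ⊗ sectionObj hs B := by
  rw [sectionObj_eq, sectionObj_eq, sectionObj_eq]
  exact s.strict.prod A B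

lemma sectionObj_unit : sectionObj hs (𝟙_ P.C) = Met.one P := by
  rw [sectionObj_eq]
  exact s.strict.unit

lemma ρ_sectionObj_prod (A B : P.C) : (sectionObj hs (A ⊗ B)).ρ =
    boxDist (D := P.toLinearDoctrine) (sectionObj hs A).ρ (sectionObj hs B).ρ :=
  Met.ρ_eq_of_eq (sectionObj_prod hs A B)

/-- The `R`-Lipschitz doctrine given by a section of the counit of the Lipschitz completion. -/
def sectionLipschitz : LipschitzDoctrine.{max u w, v, w} R where
  toGradedDoctrine := P
  dist A := (sectionObj hs A).ρ
  isDistance A := (sectionObj hs A).isDistance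
  subst A X α := by
    -- The distance on `X ⊗ A` is the product distance, so `α` is a descent datum over the product
    -- in the completion, tracked by the same grade. Substitutivity then holds because it holds in
    -- the completion.
    have hα : α ∈ Met.Des (sectionObj hs X ⊗ sectionObj hs A) := by
      obtain ⟨r, hr⟩ := mem_Des_section hs α
      exact ⟨r, (mul_le_mul' le_rfl
        (congrArg (P.bang r) (ρ_sectionObj_prod hs X A)).ge).trans hr⟩
    obtain ⟨r, hr⟩ := Met.dist_subst (P := P) (sectionObj hs A) (sectionObj hs X)
      (Met.mkFib (X := sectionObj hs X ⊗ sectionObj hs A) α hα)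
    let A' := sectionObj hs A
    let X' := sectionObj hs X
    -- These two equations translate pairings formed in the completion into pairings formed in `P`.
    have h1 := Met.re_lift_f (P := P) (fst X' (A' ⊗ A')) (snd X' (A' ⊗ A') ≫ fst A' A') α
    have h2 := Met.re_lift_f (P := P) (fst X' (A' ⊗ A')) (snd X' (A' ⊗ A') ≫ snd A' A') α
    exact ⟨r, (mul_le_mul' h1.ge le_rfl).trans (((Met.le_iff _ _).1 hr).trans h2.le)⟩
  dist_prod A X := ρ_sectionObj_prod hs A X
  dist_le_fst A X := by
    rw [ρ_sectionObj_prod]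
    -- The factor coming from `X` is affine and may be dropped from the product.
    exact mul_le_of_le_one_right' (re_le_one _ (sectionObj hs X).affine)
  dist_le_snd A X := by
    rw [ρ_sectionObj_prod]
    exact mul_le_of_le_one_left' (re_le_one _ (sectionObj hs A).affine)
  dist_unit := Met.ρ_eq_of_eq (sectionObj_unit hs)

/-- A section is recovered from its distances: by the counit law its values on arrows and elements
are the given ones up to transport, and the equality `sectionObj_eq` cancels that transport. -/
lemma lipUnit_sectionLipschitz : (lipUnit.{u, v, w} (sectionLipschitz hs)).toHom = s := by
  have hobj (A : P.C) : (sectionLipschitz hs).toMet A = s.F.obj A := sectionObj_eq hs A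
  refine GradedDoctrine.Hom.ext_data hobj (fun {X Y} g => ?_) (fun {X} α => ?_)
  · refine Met.hom_ext ?_
    -- The counit law presents the arrow under `s.F.map g` as `g` conjugated by equalities; the
    -- comparison of objects conjugates it back.
    have h : Met.Hom.f (s.F.map g) = _ := congr_map hs g
    refine Eq.trans ?_ (congrArg₂ (fun a b => a ≫ Met.Hom.f (s.F.map g) ≫ b)
      (Met.eqToHom_f (hobj X)).symm (Met.eqToHom_f (hobj Y).symm).symm)
    refine Eq.trans ?_ (congrArg (fun a => _ ≫ a ≫ _) h).symm
    exact (eqToHom_conj_cancel (congr_obj hs X).symm (congr_obj hs Y).symm g).symm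
  · refine Met.val_ext ?_
    have h : Met.val (s.app α) = _ := congr_app hs α
    exact ((congrArg₂ (fun a b => P.re a b) (Met.eqToHom_f (hobj X)) h).trans
      (Doctrine.re_eqToHom_cancel (congr_obj hs X).symm α)).symm

/-- On objects, the square of a coalgebra morphism is an equality in the completion of `Q` between
two objects over `FA`. Its second component is preservation of distances. -/
lemma distMap_section {P Q : GradedDoctrine.{max u w, v, w} R} {s : Hom P (Met.graded P)}
    {t : Hom Q (Met.graded Q)} (hs : s.comp (lipCounit P) = Hom.id P)
    (ht : t.comp (lipCounit Q) = Hom.id Q) (φ : Hom P Q)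
    (h : φ.comp t = s.comp (Met.mapGraded φ)) (A : P.C) :
    (sectionObj ht (φ.F.obj A)).ρ = φ.distMap (sectionObj hs A).ρ := by
  have h' : sectionObj ht (φ.F.obj A) = (Met.mapBase φ).obj (sectionObj hs A) := by
    rw [sectionObj_eq, sectionObj_eq]
    exact congr_obj h A
  exact Met.ρ_eq_of_eq h'

end GradedDoctrine.Hom

/-! ### Lipschitz doctrines over a fixed graded doctrine -/

namespace LipschitzDoctrine

variable {P Q : GradedDoctrine.{u, v, w} R}
  {dP dP' : ∀ A : P.C, P.fib (A ⊗ A)} {dQ dQ' : ∀ A : Q.C, Q.fib (A ⊗ A)}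

/-- The remaining fields are propositions, so a Lipschitz structure on `P` is determined by its
distances. With `hom_heq` and `hom₂_heq`, this reduces one round trip to
`dist_sectionLipschitz_lipUnit`. -/
lemma ext_dist (hP : dP = dP') (h₁ h₂ h₃ h₄ h₅ h₆ h₁' h₂' h₃' h₄' h₅' h₆') :
    (⟨P, dP, h₁, h₂, h₃, h₄, h₅, h₆⟩ : LipschitzDoctrine R) =
      ⟨P, dP', h₁', h₂', h₃', h₄', h₅', h₆'⟩ := by
  subst hP; rfl

lemma hom_heq (hP : dP = dP') (hQ : dQ = dQ')
    {h₁ h₂ h₃ h₄ h₅ h₆ h₁' h₂' h₃' h₄' h₅' h₆' k₁ k₂ k₃ k₄ k₅ k₆ k₁' k₂' k₃' k₄' k₅' k₆'}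
    (φ : (⟨P, dP, h₁, h₂, h₃, h₄, h₅, h₆⟩ : LipschitzDoctrine R) ⟶
      ⟨Q, dQ, k₁, k₂, k₃, k₄, k₅, k₆⟩)
    (φ' : (⟨P, dP', h₁', h₂', h₃', h₄', h₅', h₆'⟩ : LipschitzDoctrine R) ⟶
      ⟨Q, dQ', k₁', k₂', k₃', k₄', k₅', k₆'⟩)
    (h : φ.toHom = φ'.toHom) : φ ≍ φ' := by
  subst hP hQ
  exact heq_of_eq (Hom.ext h)

lemma hom₂_heq (hP : dP = dP') (hQ : dQ = dQ')
    {h₁ h₂ h₃ h₄ h₅ h₆ h₁' h₂' h₃' h₄' h₅' h₆' k₁ k₂ k₃ k₄ k₅ k₆ k₁' k₂' k₃' k₄' k₅' k₆'}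
    {φ ψ : (⟨P, dP, h₁, h₂, h₃, h₄, h₅, h₆⟩ : LipschitzDoctrine R) ⟶
      ⟨Q, dQ, k₁, k₂, k₃, k₄, k₅, k₆⟩}
    {φ' ψ' : (⟨P, dP', h₁', h₂', h₃', h₄', h₅', h₆'⟩ : LipschitzDoctrine R) ⟶
      ⟨Q, dQ', k₁', k₂', k₃', k₄', k₅', k₆'⟩}
    (hφ : φ.toHom = φ'.toHom) (hψ : ψ.toHom = ψ'.toHom) (a : φ ⟶ ψ) (a' : φ' ⟶ ψ')
    (h : (show φ.toHom ⟶ ψ.toHom from a) ≍ (show φ'.toHom ⟶ ψ'.toHom from a')) : a ≍ a' := by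
  subst hP hQ
  obtain rfl : φ = φ' := Hom.ext hφ
  obtain rfl : ψ = ψ' := Hom.ext hψ
  exact h

end LipschitzDoctrine

/-! ### The comparison 2-functor and its inverse -/

variable (R) in
/-- The inverse of the comparison 2-functor: a coalgebra is a section of the counit, hence a
family of distances. -/
def comparisonInv : StrictPseudofunctor
    (lipAdjunction.{u, v, w} R).comonad.Coalgebra (LipschitzDoctrine.{max u w, v, w} R) :=
  StrictPseudofunctor.mk''
    { obj := fun c => GradedDoctrine.Hom.sectionLipschitz.{u, v, w} c.counit
      map := fun {c d} φ => LipschitzDoctrine.Hom.mk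
        (P := GradedDoctrine.Hom.sectionLipschitz.{u, v, w} c.counit)
        (Q := GradedDoctrine.Hom.sectionLipschitz.{u, v, w} d.counit) φ.f
        (GradedDoctrine.Hom.distMap_section.{u, v, w} c.counit d.counit φ.f φ.comm)
      -- A 2-arrow of Lipschitz doctrines is a 2-arrow between the underlying 1-arrows, so the
      -- underlying 2-cell is all that is needed.
      map₂ := fun a => a.η
      map₂_id := fun _ => rfl
      map₂_comp := fun _ _ => rfl
      map_id := fun _ => rfl
      map_comp := fun _ _ => rfl
      map₂_whisker_left := fun _ _ _ _ => (GradedDoctrine.id_comp_id _).symm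
      map₂_whisker_right := fun _ _ => (GradedDoctrine.id_comp_id _).symm }

/-- The unit already sends `A` to an object lying over `A` definitionally, so the counit law is
`rfl` and `copy` reindexes the distance along an identity only. -/
lemma dist_sectionLipschitz_lipUnit (Q : LipschitzDoctrine.{max u w, v, w} R) :
    (GradedDoctrine.Hom.sectionLipschitz.{u, v, w} (P := Q.toGradedDoctrine)
      (s := (lipUnit.{u, v, w} Q).toHom) rfl).dist = Q.dist := by
  funext A
  exact (congrArg (fun a => Q.re a (Q.dist A)) (id_tensorHom_id A A)).trans (Doctrine.re_id _)

lemma comparison_comp_inv :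
    (lipAdjunction.{u, v, w} R).comparison.comp (comparisonInv.{u, v, w} R) =
      StrictPseudofunctor.id _ :=
  TwoCat.strictPseudofunctor_ext
    (fun Q => LipschitzDoctrine.ext_dist (dist_sectionLipschitz_lipUnit Q) _ _ _ _ _ _ _ _ _ _ _ _)
    (fun {Q S} _ => LipschitzDoctrine.hom_heq (dist_sectionLipschitz_lipUnit Q)
      (dist_sectionLipschitz_lipUnit S) _ _ rfl)
    (fun {Q S _ _} _ => LipschitzDoctrine.hom₂_heq (dist_sectionLipschitz_lipUnit Q)
      (dist_sectionLipschitz_lipUnit S) rfl rfl _ _ HEq.rfl)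

lemma inv_comp_comparison :
    (comparisonInv.{u, v, w} R).comp (lipAdjunction.{u, v, w} R).comparison =
      StrictPseudofunctor.id _ :=
  -- The round trip keeps the carrier and replaces the structure map by the unit at the associated
  -- Lipschitz doctrine; this equation identifies the two.
  have hs (c : (lipAdjunction.{u, v, w} R).comonad.Coalgebra) :=
    GradedDoctrine.Hom.lipUnit_sectionLipschitz.{u, v, w} c.counit
  TwoCat.strictPseudofunctor_ext
    (fun c => TwoCat.TwoComonad.Coalgebra.ext_str (hs c) _ _ _ _)
    (fun {c d} _ => TwoCat.TwoComonad.Coalgebra.hom_heq (hs c) (hs d) _ _ rfl)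
    (fun {c d φ ψ} a => TwoCat.TwoComonad.Coalgebra.hom₂_heq (hs c) (hs d)
      (φ := ((comparisonInv.{u, v, w} R).comp (lipAdjunction.{u, v, w} R).comparison).map φ)
      (ψ := ((comparisonInv.{u, v, w} R).comp (lipAdjunction.{u, v, w} R).comparison).map ψ)
      (φ' := φ) (ψ' := ψ) rfl rfl
      (((comparisonInv.{u, v, w} R).comp (lipAdjunction.{u, v, w} R).comparison).map₂ a) a
      HEq.rfl)

end LipDoc

/-- A single existential ties the statements together: the comparison 2-functor is the one formed
from the adjunction with the prescribed unit and counit. Bases live in universe `max u w` because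
objects of the completion contain elements of fibres, so that the completion stays in the same
2-category. -/
theorem mainTheorem1 (R : Type t) [LipDoc.ResourceSemiring R] :
    ∃ adj : TwoCat.TwoAdjunction
        (LipDoc.LipschitzDoctrine.forget.{max u w, v, w} R) (LipDoc.completion.{u, v, w} R),
      (∀ P : LipDoc.GradedDoctrine.{max u w, v, w} R,
        adj.counit.app P = LipDoc.lipCounit.{max u w, v, w} P) ∧
      (∀ Q : LipDoc.LipschitzDoctrine.{max u w, v, w} R,
        adj.unit.app Q = LipDoc.lipUnit.{u, v, w} Q) ∧
      TwoCat.IsIsoOfTwoCategories adj.comparison :=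
  ⟨LipDoc.lipAdjunction.{u, v, w} R, fun _ => rfl, fun _ => rfl,
    LipDoc.comparisonInv.{u, v, w} R, LipDoc.comparison_comp_inv, LipDoc.inv_comp_comparison⟩
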